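/- Let $\mathbb F_q$ be a finite field, let $m\ge 1$ be an integer with $(q,m)=1$, and let $n\ge 2$ be an integer. Write $x_1,\dots,x_q$ for the elements of $\mathbb F_q$, and let $\mathcal F_d$ be the set of polynomials $f\in\mathbb F_q[x]$ of degree $d$ that are $n$-th power free, i.e. not divisible by $g^n$ for any non-constant $g\in\mathbb F_q[x]$. For $f\in\mathcal F_d$ let $C_f$ be the affine curve $y^m=f(x)$ over $\mathbb F_q$ and $\tilde C_f$ its normalization. A point of $C_f$ or of $\tilde C_f$ means an $\mathbb F_q$-point; the $x$-value of a point of $\tilde C_f$ is that of its image in $C_f$. Parentheses $(a,b,\dots)$ of integers denote greatest common divisors, with $(m,0,q-1)=(m,q-1)$. Let $k_1,\dots,k_q$ be integers. (1) We have $$\lim_{d\to\infty}\frac{\#\{f\in\mathcal F_d : C_f\text{ has }k_i\text{ points with }x=x_i\text{ for all }i\}}{\#\mathcal F_d}=\mathrm{Prob}(X_i=k_i\text{ for all }i),$$ where $X_1,\dots,X_q$ are independent and identically distributed random variables with $$X_j=\begin{cases}0&\text{with probability }\left(1-\frac1{(m,q-1)}\right)\frac{1-q^{-1}}{1-q^{-n}},\\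 1&\text{with probability }\frac{q^{-1}-q^{-n}}{1-q^{-n}},\\ (m,q-1)&\text{with probability }\frac1{(m,q-1)}\cdot\frac{1-q^{-1}}{1-q^{-n}},\end{cases}$$ where, when $(m,q-1)=1$, the last two probabilities are added to give $\mathrm{Prob}(X_j=1)$. (2) We have $$\lim_{d\to\infty}\frac{\#\{f\in\mathcal F_d : \tilde C_f\text{ has }k_i\text{ points with }x=x_i\text{ for all }i\}}{\#\mathcal F_d}=\mathrm{Prob}(X_i=k_i\text{ for all }i),$$ where $X_1,\dots,X_q$ are independent and identically distributed random variables with $$X_j=\begin{cases}0&\text{with probability }\displaystyle\sum_{0\le s\le n-1}\left(1-\frac1{(m,s,q-1)}\right)\frac{q^{-s}(1-q^{-1})}{1-q^{-n}},\\ N&\text{with probability }\displaystyle\sum_{\substack{0\le s\le n-1\\(m,s,q-1)=N}}\frac{q^{-s}(1-q^{-1})}{N(1-q^{-n})}\quad(N\ge1).\end{cases}$$ In both parts the displayed numbers are the masses of a probability distribution. (3) Both limits remain the same if, in numerator and denominator, $f$ is restricted to those polynomials for which $C_f$ is irreducible, or to those for which $C_f$ is geometrically irreducible, or to those for which $\tilde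 C_f$ is irreducible, or to those for which $\tilde C_f$ is geometrically irreducible. -/

import Mathlib

open Polynomial Filter Topology MeasureTheory ProbabilityTheory
open scoped TensorProduct

noncomputable section

namespace Superelliptic

section Curve

variable {F : Type*} [Field F]

/-- A polynomial is `n`-th power free if no `n`-th power of a non-constant polynomial divides it.
(The zero polynomial is not `n`-th power free.) -/
def PowerFree (n : ℕ) (f : F[X]) : Prop :=
  ∀ g : F[X], g ^ n ∣ f → IsUnit g

/-- The polynomial `y ^ m - f(x)`, as a polynomial in `y` with coefficients in `F[x]`. -/
abbrev eqn (m : ℕ) (f : F[X]) : F[X][X] := X ^ m - C f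

/-- The coordinate ring `F[x, y] / (y ^ m - f(x))` of the affine curve `C_f`. -/
abbrev CoordRing (m : ℕ) (f : F[X]) : Type _ := AdjoinRoot (eqn m f)

/-- The coordinate ring of the normalization of `C_f`: the integral closure of the coordinate
ring of `C_f` in its total ring of fractions (its localization at all non-zero-divisors). -/
abbrev NormRing (m : ℕ) (f : F[X]) : Type _ :=
  integralClosure (CoordRing m f) (FractionRing (CoordRing m f))

/-- The function `x` on the normalization of `C_f`, i.e. the pullback of the coordinate under
normalization of `C_f` → `C_f` → affine line. -/
def xCoord (m : ℕ) (f : F[X]) : NormRing m f :=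
  algebraMap (CoordRing m f) (NormRing m f) (AdjoinRoot.of (eqn m f) X)

/-- The number of `F`-points `(a, y)` of `C_f` lying over `x = a`. -/
def numPoints (m : ℕ) (f : F[X]) (a : F) : ℕ :=
  Nat.card {y : F // y ^ m = f.eval a}

/-- The number of `F`-points of the normalization of `C_f` lying over `x = a`; an `F`-point of an
affine `F`-scheme is an `F`-algebra homomorphism from its coordinate ring to `F`. -/
def numPointsNorm (m : ℕ) (f : F[X]) (a : F) : ℕ :=
  Nat.card {φ : NormRing m f →ₐ[F] F // φ (xCoord m f) = a}

/-- `C_f` is irreducible: `y ^ m - f(x)` is irreducible in `F[x, y]`. -/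
def CurveIrred (m : ℕ) (f : F[X]) : Prop := Irreducible (eqn m f)

/-- `C_f` is geometrically irreducible: `y ^ m - f(x)` is irreducible over the algebraic
closure of `F`. -/
def CurveGeomIrred (m : ℕ) (f : F[X]) : Prop :=
  Irreducible (eqn m (f.map (algebraMap F (AlgebraicClosure F))))

/-- The normalization of `C_f` is irreducible. -/
def NormIrred (m : ℕ) (f : F[X]) : Prop :=
  IrreducibleSpace (PrimeSpectrum (NormRing m f))

/-- The normalization of `C_f` is geometrically irreducible: its base change to the algebraic
closure of `F` is irreducible. -/
def NormGeomIrred (m : ℕ) (f : F[X]) : Prop :=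
  IrreducibleSpace (PrimeSpectrum (AlgebraicClosure F ⊗[F] NormRing m f))

/-- Among the `n`-th power free `f` of degree `d` which satisfy the restriction `R`, the proportion
of those with `N f a = k a` for all `a`. -/
def proportion (n : ℕ) (R : F[X] → Prop) (N : F[X] → F → ℕ) (k : F → ℤ) (d : ℕ) : ℝ :=
  ({f : F[X] | f.degree = d ∧ PowerFree n f ∧ R f ∧ ∀ a, (N f a : ℤ) = k a}.ncard : ℝ) /
    ({f : F[X] | f.degree = d ∧ PowerFree n f ∧ R f}.ncard : ℝ)

end Curve

section Law

/-- The limit law for the number of points of `C_f` over one `x`-value. The three terms add up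
where the values `0`, `1`, `gcd(m, q - 1)` coincide. -/
def curveLaw (q m n : ℕ) (k : ℤ) : ℝ :=
  (if k = 0 then
      (1 - 1 / (m.gcd (q - 1) : ℝ)) * ((1 - (q : ℝ)⁻¹) / (1 - ((q : ℝ) ^ n)⁻¹)) else 0) +
  (if k = 1 then
      ((q : ℝ)⁻¹ - ((q : ℝ) ^ n)⁻¹) / (1 - ((q : ℝ) ^ n)⁻¹) else 0) +
  (if k = (m.gcd (q - 1) : ℤ) then
      1 / (m.gcd (q - 1) : ℝ) * ((1 - (q : ℝ)⁻¹) / (1 - ((q : ℝ) ^ n)⁻¹)) else 0)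

/-- The limit law for the number of points of the normalization of `C_f` over one `x`-value. -/
def normLaw (q m n : ℕ) (k : ℤ) : ℝ :=
  if k = 0 then
    ∑ s ∈ Finset.range n, (1 - 1 / ((m.gcd s).gcd (q - 1) : ℝ)) *
      (((q : ℝ) ^ s)⁻¹ * (1 - (q : ℝ)⁻¹) / (1 - ((q : ℝ) ^ n)⁻¹))
  else
    ∑ s ∈ Finset.range n with (((m.gcd s).gcd (q - 1) : ℕ) : ℤ) = k,
      ((q : ℝ) ^ s)⁻¹ * (1 - (q : ℝ)⁻¹) / ((k : ℝ) * (1 - ((q : ℝ) ^ n)⁻¹))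

/-- `p` is the mass function of a probability distribution on the integers. -/
def IsProbLaw (p : ℤ → ℝ) : Prop := (∀ k, 0 ≤ p k) ∧ HasSum p 1

/-- The integer-valued random variables `X i` are independent, each with mass function `p`. -/
def IsIID {ι Ω : Type*} [MeasurableSpace Ω] (P : Measure Ω) (X : ι → Ω → ℤ) (p : ℤ → ℝ) : Prop :=
  (∀ i, Measurable (X i)) ∧ iIndepFun X P ∧ ∀ i k, P.real {ω | X i ω = k} = p k

end Law

end Superelliptic

end

/-!
Both point counts over `x = a` depend only on the first `n` coefficients of the expansion of `f` in
powers of `x - a` (`localData`), which are not all zero when `f` is `n`-th power free. The theorem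
holds because these local data become independent over the various `a` and uniformly distributed
on the nonzero vectors of `F ^ n`; both laws are the image of this uniform distribution.

*Points of the normalization.* Let `f = (x - a) ^ s g` with `g(a) ≠ 0`, and let `r = gcd(m, s)`.
Since `m` is invertible in `F`, the normalization is graded by the exponent of `y` modulo `m`: over
an algebraic closure of `F(x)` a homogeneous component is an average over the `m`-th roots of unity,
hence integral. The function `z = y ^ (m / r) / (x - a) ^ (s / r)` satisfies `z ^ r = g`, and at a
point over `a` a homogeneous element either vanishes or is a unit of `F[x]` at `a` times a power of
`z`. So a point is determined by the value of `z`, and by lying-over every `r`-th root of `g(a)`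
occurs (`IsNormalModel.card_points`). On the curve itself one counts `m`-th roots of `f(a)`. In both
cases the count is a `leadingRootCount`, whose distribution follows from the cyclicity of `Fˣ`
(`leadingRootCount_law`).

*Equidistribution.* Given nonzero local data `u` and `u'`, there is a polynomial with local data
`u' - u` that is divisible by `g ^ n` for all `g` of degree at most `M` without rational roots.
Adding it maps the power free `f` with local data `u` to polynomials with local data `u'` that are
power free up to squares of polynomials of degree at least `M` (`ncard_localData_le`), which are
rare (`ncard_sq_dvd_large_le`). As a positive proportion of all polynomials is power free
(`le_ncard_powerFree`), all local data have the same limiting frequency.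

*Irreducibility.* If `f` has a simple irreducible factor, Eisenstein's criterion makes `y ^ m - f`
irreducible over `F`, and also over the algebraic closure because `F` is perfect. Then the
normalization is a domain, and so is its base change. A polynomial without a simple irreducible
factor has a square factor of degree at least two thirds of its own, so such polynomials are
negligible (`holdsAlmostSurely_of_simple_factor`).
-/

namespace Superelliptic

/-! ### Points of the normalization over one `x`-value -/

section NormalModel

/-- Averaging over the `m`-th roots of unity extracts one homogeneous component of a polynomial
in `w`. -/
lemma sum_rootsOfUnity_mul_sum {K : Type*} [Field K] {m : ℕ} {ζ : K} (hζ : IsPrimitiveRoot ζ m)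
    (c : ℕ → K) (w : K) {e : ℕ} (he : e < m) :
    ∑ i ∈ Finset.range m, ζ ^ (i * (m - e)) * ∑ j ∈ Finset.range m, c j * (ζ ^ i * w) ^ j =
      m * (c e * w ^ e) := by
  have key : ∀ j ∈ Finset.range m, ∑ i ∈ Finset.range m, (ζ ^ (m - e + j)) ^ i =
      if j = e then (m : K) else 0 := by
    intro j hj
    rw [Finset.mem_range] at hj
    split_ifs with h
    · subst h
      rw [Nat.sub_add_cancel hj.le, hζ.pow_eq_one]
      simp
    · have h1 : ζ ^ (m - e + j) ≠ 1 := by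
        rw [Ne, hζ.pow_eq_one_iff_dvd]
        rintro ⟨l, hl⟩
        have : l = 1 := by
          have h2 : 0 < m * l := by omega
          have h3 : m * l < m * 2 := by omega
          have := Nat.lt_of_mul_lt_mul_left h3
          have := Nat.pos_of_mul_pos_left h2
          omega
        subst this
        omega
      have h2 := geom_sum_mul (ζ ^ (m - e + j)) m
      rw [← pow_mul, mul_comm _ m, pow_mul, hζ.pow_eq_one, one_pow, sub_self] at h2
      exact (mul_eq_zero.mp h2).resolve_right (sub_ne_zero.mpr h1)
  calc _ = ∑ j ∈ Finset.range m, c j * w ^ j * ∑ i ∈ Finset.range m, (ζ ^ (m - e + j)) ^ i := by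
        simp_rw [Finset.mul_sum]
        rw [Finset.sum_comm]
        refine Finset.sum_congr rfl fun j _ => Finset.sum_congr rfl fun i _ => ?_
        rw [mul_pow, ← pow_mul, ← pow_mul, Nat.add_mul, pow_add, mul_comm i, mul_comm i]
        ring
    _ = _ := by
        rw [Finset.sum_congr rfl fun j hj => by rw [key j hj]]
        simp [he, mul_comm]

variable {F : Type*} [Field F]

/-- The properties of the normalization `B` of `y ^ m = f(x)` over the affine `x`-line that
determine its points: `B` is an integral torsion-free `F[x]`-algebra that is spanned by the powers
of `y` up to denominators from `F[x]`, it contains every quotient `b / p` (`p ∈ F[x]`) that is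
integral because one of its powers lies in `B`, and it maps to a field `Ω` under sending `y` to any
`m`-th root of `f`. -/
structure IsNormalModel (m : ℕ) (f : F[X]) {B : Type*} [CommRing B] [Algebra F[X] B] (y : B)
    (Ω : Type*) [Field Ω] [Algebra F[X] Ω] : Prop where
  pow_eq : y ^ m = algebraMap F[X] B f
  smul_cancel : ∀ p : F[X], p ≠ 0 → ∀ b : B, p • b = 0 → b = 0
  exists_smul_eq_sum : ∀ b : B, ∃ p : F[X], p ≠ 0 ∧ ∃ c : ℕ → F[X],
    p • b = ∑ i ∈ Finset.range m, c i • y ^ i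
  indep : ∀ c : ℕ → F[X], ∑ i ∈ Finset.range m, c i • y ^ i = 0 → ∀ i < m, c i = 0
  isIntegral : ∀ b : B, IsIntegral F[X] b
  exists_eq_smul : ∀ p : F[X], p ≠ 0 → ∀ (b c : B) (j : ℕ), 0 < j → b ^ j = p ^ j • c →
    ∃ b', b = p • b'
  exists_hom : ∀ η : Ω, η ^ m = algebraMap F[X] Ω f → ∃ σ : B →ₐ[F[X]] Ω, σ y = η

/-- `p` divides `g` in `F[x]` as soon as `g / p` is integral over `F[x]`. -/
lemma dvd_of_isIntegral {Ω : Type*} [Field Ω] [Algebra F[X] Ω]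
    (hinj : Function.Injective (algebraMap F[X] Ω)) {p g : F[X]} (hp : p ≠ 0) {w : Ω}
    (hw : IsIntegral F[X] w) (h : algebraMap F[X] Ω p * w = algebraMap F[X] Ω g) : p ∣ g := by
  let K := FractionRing F[X]
  let ι : K →ₐ[F[X]] Ω := IsLocalization.liftAlgHom (M := nonZeroDivisors F[X])
    (f := Algebra.ofId F[X] Ω) fun s => by
      refine IsUnit.mk0 _ ?_
      exact (map_ne_zero_iff _ hinj).mpr (nonZeroDivisors.coe_ne_zero s)
  have hpK : algebraMap F[X] K p ≠ 0 := (map_ne_zero_iff _ (IsFractionRing.injective _ _)).mpr hp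
  have hpΩ : algebraMap F[X] Ω p ≠ 0 := (map_ne_zero_iff _ hinj).mpr hp
  have hι : ι (algebraMap F[X] K g / algebraMap F[X] K p) = w := by
    rw [map_div₀, AlgHom.commutes, AlgHom.commutes, ← h]
    field_simp
  rw [← hι, isIntegral_algHom_iff ι ι.toRingHom.injective] at hw
  obtain ⟨u, hu⟩ := IsIntegrallyClosed.isIntegral_iff.mp hw
  refine ⟨u, IsFractionRing.injective F[X] K ?_⟩
  rw [map_mul, hu, mul_div_cancel₀ _ hpK]

lemma algebraMap_ne_zero_of_ne_zero (L : Type*) [CommRing L] [Nontrivial L] [Algebra F L] {u : F}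
    (hu : u ≠ 0) : algebraMap F L u ≠ 0 :=
  (map_ne_zero_iff _ (algebraMap F L).injective).mpr hu

lemma map_smul_of_eval {B : Type*} [CommRing B] [Algebra F[X] B] {L : Type*} [CommRing L]
    [Algebra F L] {φ : B →+* L} {a : F}
    (hφ : ∀ q : F[X], φ (algebraMap F[X] B q) = algebraMap F L (q.eval a)) (q : F[X]) (b : B) :
    φ (q • b) = algebraMap F L (q.eval a) * φ b := by
  rw [Algebra.smul_def, map_mul, hφ]

namespace IsNormalModel

variable {m : ℕ} {f : F[X]} {B : Type*} [CommRing B] [Algebra F[X] B] {y : B}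
  {Ω : Type*} [Field Ω] [Algebra F[X] Ω]

lemma smul_left_cancel (h : IsNormalModel m f y Ω) {p : F[X]} (hp : p ≠ 0) {b c : B}
    (hbc : p • b = p • c) : b = c :=
  sub_eq_zero.mp (h.smul_cancel p hp _ (by rw [smul_sub, hbc, sub_self]))

/-- The normalization is graded by the exponent of `y` modulo `m`: every element is a sum of
elements that are a rational function of `x` times a power of `y`. -/
lemma exists_eq_sum_homogeneous [IsAlgClosed Ω] (h : IsNormalModel m f y Ω)
    (hinj : Function.Injective (algebraMap F[X] Ω)) (hm : (m : F) ≠ 0) (b : B) :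
    ∃ p : F[X], p ≠ 0 ∧ ∃ (c : ℕ → F[X]) (β : ℕ → B),
      b = ∑ e ∈ Finset.range m, β e ∧
        ∀ e < m, p • β e = c e • y ^ e ∧ p ^ m ∣ c e ^ m * f ^ e := by
  obtain ⟨p, hp, c, hc⟩ := h.exists_smul_eq_sum b
  have hm0 : m ≠ 0 := by rintro rfl; simp at hm
  let _ : Algebra F Ω := ((algebraMap F[X] Ω).comp C).toAlgebra
  have hmΩ : (m : Ω) ≠ 0 := by
    have := (map_ne_zero_iff (algebraMap F Ω) (algebraMap F Ω).injective).mpr hm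
    simpa using this
  have : NeZero (m : Ω) := ⟨hmΩ⟩
  have : NeZero m := ⟨hm0⟩
  obtain ⟨ζ, hζ⟩ := HasEnoughRootsOfUnity.exists_primitiveRoot Ω m
  obtain ⟨η, hη⟩ := IsAlgClosed.exists_pow_nat_eq (algebraMap F[X] Ω f) (Nat.pos_of_ne_zero hm0)
  have hζint : IsIntegral F[X] ζ :=
    IsIntegral.of_pow (Nat.pos_of_ne_zero hm0) (by rw [hζ.pow_eq_one]; exact isIntegral_one)
  have hσ : ∀ i : ℕ, ∃ σ : B →ₐ[F[X]] Ω, σ y = ζ ^ i * η := fun i => h.exists_hom _ (by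
    rw [mul_pow, ← pow_mul, mul_comm i, pow_mul, hζ.pow_eq_one, one_pow, one_mul, hη])
  choose σ hσ using hσ
  have hdvd : ∀ e < m, p ^ m ∣ c e ^ m * f ^ e := by
    intro e he
    have h1 := sum_rootsOfUnity_mul_sum hζ (fun j => algebraMap F[X] Ω (c j)) η he
    have h2 : ∀ i, ∑ j ∈ Finset.range m, algebraMap F[X] Ω (c j) * (ζ ^ i * η) ^ j =
        algebraMap F[X] Ω p * σ i b := by
      intro i
      rw [← Algebra.smul_def, ← map_smul, hc, map_sum]
      exact Finset.sum_congr rfl fun j _ => by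
        rw [map_smul, map_pow, hσ, Algebra.smul_def]
    simp_rw [h2] at h1
    set θ : Ω := algebraMap F[X] Ω (C (m : F)⁻¹) *
      ∑ i ∈ Finset.range m, ζ ^ (i * (m - e)) * σ i b with hθ
    have hθint : IsIntegral F[X] θ :=
      isIntegral_algebraMap.mul (IsIntegral.sum _ fun i _ =>
        (hζint.pow _).mul ((h.isIntegral b).map (σ i)))
    have h3 : algebraMap F[X] Ω p * θ = algebraMap F[X] Ω (c e) * η ^ e := by
      have h4 : algebraMap F[X] Ω (C (m : F)⁻¹) * (m : Ω) = 1 := by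
        rw [← map_natCast (algebraMap F[X] Ω), ← map_mul, ← C_eq_natCast, ← C_mul,
          inv_mul_cancel₀ hm, C_1, map_one]
      calc algebraMap F[X] Ω p * θ = algebraMap F[X] Ω (C (m : F)⁻¹) *
            ∑ i ∈ Finset.range m, ζ ^ (i * (m - e)) * (algebraMap F[X] Ω p * σ i b) := by
            rw [hθ, Finset.mul_sum, Finset.mul_sum, Finset.mul_sum]
            exact Finset.sum_congr rfl fun i _ => by ring
        _ = _ := by rw [h1, ← mul_assoc, h4, one_mul]
    refine dvd_of_isIntegral hinj (pow_ne_zero m hp) (hθint.pow m) ?_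
    rw [map_pow, ← mul_pow, h3, mul_pow, ← pow_mul, mul_comm e, pow_mul, hη]
    simp
  have hβ : ∀ e, ∃ β : B, e < m → c e • y ^ e = p • β := by
    intro e
    by_cases he : e < m
    · obtain ⟨w, hw⟩ := hdvd e he
      obtain ⟨β, hβ⟩ := h.exists_eq_smul p hp (c e • y ^ e) (algebraMap F[X] B w) m
        (Nat.pos_of_ne_zero hm0) (by
          rw [_root_.smul_pow, ← pow_mul, mul_comm e, pow_mul, h.pow_eq, Algebra.smul_def,
            Algebra.smul_def, ← map_pow, ← map_mul, ← map_mul, hw])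
      exact ⟨β, fun _ => hβ⟩
    · exact ⟨0, fun h => absurd h he⟩
  choose β hβ using hβ
  refine ⟨p, hp, c, β, h.smul_left_cancel hp ?_, fun e he => ⟨(hβ e he).symm, hdvd e he⟩⟩
  rw [hc, Finset.smul_sum]
  exact Finset.sum_congr rfl fun e he => hβ e (Finset.mem_range.mp he)

/-- A homogeneous element `β = c yᵉ / p` takes at a point over `x = a` a value that is a polynomial
in the value of `z = y ^ m' / (x - a) ^ s'`: either a power of `β` vanishes at `a`, or comparing
orders of vanishing at `a` shows that `β` is a unit at `a` times a power of `z`. -/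
lemma exists_apply_homogeneous_eq (h : IsNormalModel m f y Ω) (hm : m ≠ 0) {a : F}
    {s r m' s' : ℕ} {g : F[X]} (hf : f = (X - C a) ^ s * g) (hg : g.eval a ≠ 0)
    (hm' : m = r * m') (hs' : s = r * s') (hcop : m'.Coprime s') {z : B}
    (hz : (X - C a) ^ s' • z = y ^ m') {p c : F[X]} (hp : p ≠ 0) {e : ℕ} {β : B}
    (hβ : p • β = c • y ^ e) (hdvd : p ^ m ∣ c ^ m * f ^ e) :
    ∃ P : F[X], ∀ (L : Type*) [CommRing L] [IsDomain L] [Algebra F L] (φ : B →+* L),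
      (∀ q : F[X], φ (algebraMap F[X] B q) = algebraMap F L (q.eval a)) →
        φ β = aeval (φ z) P := by
  have ht : (X - C a : F[X]) ≠ 0 := X_sub_C_ne_zero a
  have hgt : ¬ (X - C a) ∣ g := fun hd => hg (dvd_iff_isRoot.mp hd)
  have hpow : p ^ m • β ^ m = algebraMap F[X] B (c ^ m * f ^ e) := by
    rw [← _root_.smul_pow, hβ, _root_.smul_pow, ← pow_mul, mul_comm e, pow_mul, h.pow_eq,
      Algebra.smul_def, ← map_pow, ← map_mul]
  by_cases hc : c = 0
  · refine ⟨0, fun L _ _ _ φ _ => ?_⟩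
    have : β = 0 := h.smul_cancel p hp β (by rw [hβ, hc, zero_smul])
    simp [this]
  obtain ⟨p₀, hp₀, hp₀t⟩ := exists_eq_pow_rootMultiplicity_mul_and_not_dvd p hp a
  obtain ⟨c₀, hc₀, hc₀t⟩ := exists_eq_pow_rootMultiplicity_mul_and_not_dvd c hc a
  set v := p.rootMultiplicity a
  set w := c.rootMultiplicity a
  have hr : r ≠ 0 := by rintro rfl; simp at hm'; omega
  have hp₀a : p₀.eval a ≠ 0 := fun h0 => hp₀t (dvd_iff_isRoot.mpr h0)
  -- Clearing the powers of `x - a` from `p ^ m * β ^ m = c ^ m * f ^ e`.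
  have hpow' : (X - C a) ^ (v * m) • (p₀ ^ m • β ^ m) =
      (X - C a) ^ (w * m + s * e) • algebraMap F[X] B (c₀ ^ m * g ^ e) := by
    have h1 : (X - C a) ^ (v * m) * p₀ ^ m = p ^ m := by
      conv_rhs => rw [hp₀]
      ring
    have h2 : (X - C a) ^ (w * m + s * e) * (c₀ ^ m * g ^ e) = c ^ m * f ^ e := by
      conv_rhs => rw [hc₀, hf]
      ring
    rw [smul_smul, h1, hpow, Algebra.smul_def, ← map_mul, h2]
  rcases lt_trichotomy (v * m) (w * m + s * e) with hlt | heq | hgt'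
  · -- `β` vanishes at the points over `a`.
    refine ⟨0, fun L _ _ _ φ hφ => ?_⟩
    have h1 : p₀ ^ m • β ^ m = (X - C a) ^ (w * m + s * e - v * m) •
        algebraMap F[X] B (c₀ ^ m * g ^ e) := by
      refine h.smul_left_cancel (pow_ne_zero (v * m) ht) ?_
      rw [hpow', smul_smul, ← pow_add, Nat.add_sub_cancel' hlt.le]
    have h2 := congrArg φ h1
    rw [map_smul_of_eval hφ, map_smul_of_eval hφ] at h2
    have h3 : ((X - C a : F[X]) ^ (w * m + s * e - v * m)).eval a = 0 := by
      rw [eval_pow]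
      simp only [eval_sub, eval_X, eval_C, sub_self]
      exact zero_pow (by omega)
    rw [h3, map_zero, zero_mul, map_pow] at h2
    have h4 : algebraMap F L ((p₀ ^ m).eval a) ≠ 0 :=
      algebraMap_ne_zero_of_ne_zero L (by rw [eval_pow]; exact pow_ne_zero _ hp₀a)
    have h5 := (mul_eq_zero.mp h2).resolve_left h4
    rw [map_zero]
    exact pow_eq_zero_iff hm |>.mp h5
  · -- Here `m'` divides `e`, and `β` is a unit at `a` times a power of `z`.
    have hdvd : m' ∣ e := by
      have h1 : r * (v * m') = r * (w * m' + s' * e) := by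
        calc r * (v * m') = v * m := by rw [hm']; ring
          _ = w * m + s * e := heq
          _ = _ := by rw [hm', hs']; ring
      have h2 := Nat.eq_of_mul_eq_mul_left (Nat.pos_of_ne_zero hr) h1
      have h3 : m' ∣ s' * e := by
        rw [← Nat.dvd_add_right (Dvd.intro_left w rfl), ← h2]
        exact Dvd.intro_left v rfl
      exact hcop.dvd_of_dvd_mul_left h3
    obtain ⟨i, rfl⟩ := hdvd
    have hv : v = w + s' * i := by
      have h1 : m * v = m * (w + s' * i) := by
        calc m * v = v * m := mul_comm _ _
          _ = w * m + s * (m' * i) := heq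
          _ = _ := by rw [hm', hs']; ring
      exact Nat.eq_of_mul_eq_mul_left (Nat.pos_of_ne_zero hm) h1
    have hpβ : p₀ • β = c₀ • z ^ i := by
      refine h.smul_left_cancel (pow_ne_zero v ht) ?_
      rw [smul_smul, ← hp₀, hβ, pow_mul, ← hz, _root_.smul_pow, smul_smul, smul_smul, ← pow_mul, hv]
      conv_lhs => rw [hc₀]
      congr 1
      ring
    refine ⟨C (c₀.eval a / p₀.eval a) * X ^ i, fun L _ _ _ φ hφ => ?_⟩
    refine mul_left_cancel₀ (algebraMap_ne_zero_of_ne_zero L hp₀a) ?_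
    rw [← map_smul_of_eval hφ, hpβ, map_smul_of_eval hφ, map_mul, aeval_C, map_pow, map_pow,
      aeval_X, ← mul_assoc, ← map_mul, mul_div_cancel₀ _ hp₀a]
  · -- This case would make `β` have a pole over `a`.
    exfalso
    have h1 : (X - C a) ^ (v * m) ∣ (X - C a) ^ (w * m + s * e) * (c₀ ^ m * g ^ e) := by
      have h2 : (X - C a) ^ (v * m) ∣ p ^ m := by
        rw [pow_mul]
        exact pow_dvd_pow_of_dvd (Dvd.intro _ hp₀.symm) m
      have h3 : (X - C a) ^ (w * m + s * e) * (c₀ ^ m * g ^ e) = c ^ m * f ^ e := by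
        conv_rhs => rw [hc₀, hf]
        ring
      exact h3 ▸ h2.trans hdvd
    rw [← Nat.add_sub_cancel' hgt'.le, pow_add, mul_dvd_mul_iff_left (pow_ne_zero _ ht)] at h1
    have hprime := prime_X_sub_C a
    rcases hprime.dvd_or_dvd ((dvd_pow_self _ (by omega)).trans h1) with h4 | h4
    · exact hc₀t (hprime.dvd_of_dvd_pow h4)
    · exact hgt (hprime.dvd_of_dvd_pow h4)

/-- The value of an element of the normalization at a point over `x = a` is a polynomial in the
value of `z = y ^ m' / (x - a) ^ s'`; the polynomial does not depend on the point. -/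
lemma exists_apply_eq_aeval [IsAlgClosed Ω] (h : IsNormalModel m f y Ω)
    (hinj : Function.Injective (algebraMap F[X] Ω)) (hm : (m : F) ≠ 0) {a : F}
    {s r m' s' : ℕ} {g : F[X]} (hf : f = (X - C a) ^ s * g) (hg : g.eval a ≠ 0)
    (hm' : m = r * m') (hs' : s = r * s') (hcop : m'.Coprime s') {z : B}
    (hz : (X - C a) ^ s' • z = y ^ m') (b : B) :
    ∃ P : F[X], ∀ (L : Type*) [CommRing L] [IsDomain L] [Algebra F L] (φ : B →+* L),
      (∀ q : F[X], φ (algebraMap F[X] B q) = algebraMap F L (q.eval a)) →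
        φ b = aeval (φ z) P := by
  have hm0 : m ≠ 0 := by rintro rfl; simp at hm
  obtain ⟨p, hp, c, β, rfl, hβ⟩ := h.exists_eq_sum_homogeneous hinj hm b
  have hP : ∀ e, ∃ P : F[X], e < m → ∀ (L : Type _) [CommRing L] [IsDomain L] [Algebra F L]
      (φ : B →+* L), (∀ q : F[X], φ (algebraMap F[X] B q) = algebraMap F L (q.eval a)) →
        φ (β e) = aeval (φ z) P := by
    intro e
    by_cases he : e < m
    · obtain ⟨P, hP⟩ := h.exists_apply_homogeneous_eq hm0 hf hg hm' hs' hcop hz hp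
        (hβ e he).1 (hβ e he).2
      exact ⟨P, fun _ => hP⟩
    · exact ⟨0, fun h => absurd h he⟩
  choose P hP using hP
  refine ⟨∑ e ∈ Finset.range m, P e, fun L _ _ _ φ hφ => ?_⟩
  rw [map_sum, map_sum]
  exact Finset.sum_congr rfl fun e he => hP e (Finset.mem_range.mp he) L φ hφ

/-- `z ^ r - g(x)` is the minimal polynomial of `z = y ^ m' / (x - a) ^ s'`. -/
lemma dvd_of_eval₂_eq_zero (h : IsNormalModel m f y Ω) {a : F}
    {r m' s' : ℕ} {g : F[X]} (hm0 : m ≠ 0) (hm' : m = r * m') {z : B}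
    (hz : (X - C a) ^ s' • z = y ^ m') (hzr : z ^ r = algebraMap F[X] B g) {H : F[X][X]}
    (hH : eval₂ (algebraMap F[X] B) z H = 0) : X ^ r - C g ∣ H := by
  have hr : r ≠ 0 := by rintro rfl; simp at hm'; omega
  have hm'0 : 0 < m' := Nat.pos_of_ne_zero (by rintro rfl; simp at hm'; omega)
  have hmon : (X ^ r - C g : F[X][X]).Monic := monic_X_pow_sub_C g hr
  rw [← modByMonic_eq_zero_iff_dvd hmon]
  set ρ := H %ₘ (X ^ r - C g)
  have hρ : eval₂ (algebraMap F[X] B) z ρ = 0 := by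
    have h1 := congrArg (eval₂ (algebraMap F[X] B) z) (modByMonic_add_div H (X ^ r - C g))
    rw [hH, eval₂_add, eval₂_mul, eval₂_sub, eval₂_X_pow, eval₂_C, hzr, sub_self, zero_mul,
      add_zero] at h1
    exact h1
  have hdeg : ρ.natDegree < r := by
    have := natDegree_modByMonic_lt H hmon (by
      intro h1
      have := congrArg natDegree h1
      rw [natDegree_X_pow_sub_C, natDegree_one] at this
      exact hr this)
    rwa [natDegree_X_pow_sub_C] at this
  rw [eval₂_eq_sum_range' _ hdeg] at hρ
  have ht : (X - C a : F[X]) ≠ 0 := X_sub_C_ne_zero a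
  -- The coefficients of `ρ`, spread over the exponents that are multiples of `m'`.
  have h2 := h.indep (fun j => if m' ∣ j then
    (X - C a) ^ (s' * (r - 1 - j / m')) * ρ.coeff (j / m') else 0) (by
      have h3 : ∑ i ∈ Finset.range r, ((X - C a) ^ (s' * (r - 1 - i)) * ρ.coeff i) • y ^ (m' * i) =
          0 := by
        calc _ = (X - C a) ^ (s' * (r - 1)) •
              ∑ i ∈ Finset.range r, algebraMap F[X] B (ρ.coeff i) * z ^ i := by
              rw [Finset.smul_sum]
              refine Finset.sum_congr rfl fun i hi => ?_
              rw [Finset.mem_range] at hi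
              rw [pow_mul y, ← hz, _root_.smul_pow, smul_smul, ← Algebra.smul_def, smul_smul,
                ← pow_mul]
              congr 1
              have : s' * (r - 1) = s' * (r - 1 - i) + s' * i := by
                rw [← mul_add]
                congr 1
                omega
              rw [this, pow_add]
              ring
          _ = 0 := by rw [hρ, smul_zero]
      rw [← h3]
      symm
      refine Finset.sum_of_injOn (fun i => m' * i) ?_ ?_ ?_ ?_
      · intro i _ j _ hij
        exact Nat.eq_of_mul_eq_mul_left hm'0 hij
      · intro i hi
        simp only [Finset.coe_range, Set.mem_Iio] at hi ⊢
        rw [hm', mul_comm r]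
        exact Nat.mul_lt_mul_of_pos_left hi hm'0
      · intro j hj hj'
        rw [if_neg, zero_smul]
        rintro ⟨i, rfl⟩
        refine hj' ⟨i, ?_, rfl⟩
        simp only [Finset.coe_range, Set.mem_Iio, Finset.mem_range] at hj ⊢
        rw [hm', mul_comm r] at hj
        exact Nat.lt_of_mul_lt_mul_left hj
      · intro i _
        simp [Nat.mul_div_cancel_left i hm'0])
  ext1 i
  rw [coeff_zero]
  by_cases hi : i < r
  · have h4 := h2 (m' * i) (by
      rw [hm', mul_comm r]
      exact Nat.mul_lt_mul_of_pos_left hi hm'0)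
    simp only [dvd_mul_right, if_true, Nat.mul_div_cancel_left i hm'0] at h4
    exact (mul_eq_zero.mp h4).resolve_left (pow_ne_zero _ ht)
  · exact coeff_eq_zero_of_natDegree_lt (by omega)

/-- Every `r`-th root of `g(a)` is the value of `z = y ^ m' / (x - a) ^ s'` at a rational point
over `x = a`: a prime ideal over `(x - a, z - γ)` has residue field `F`, because all values at it
are polynomials in the value of `z`. -/
lemma exists_algHom [IsAlgClosed Ω] (h : IsNormalModel m f y Ω)
    (hinj : Function.Injective (algebraMap F[X] Ω)) (hm : (m : F) ≠ 0) {a : F}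
    {s r m' s' : ℕ} {g : F[X]} (hf : f = (X - C a) ^ s * g) (hg : g.eval a ≠ 0)
    (hm' : m = r * m') (hs' : s = r * s') (hcop : m'.Coprime s') {z : B}
    (hz : (X - C a) ^ s' • z = y ^ m') (hzr : z ^ r = algebraMap F[X] B g)
    {γ : F} (hγ : γ ^ r = g.eval a) :
    ∃ φ : B →+* F, (∀ q : F[X], φ (algebraMap F[X] B q) = q.eval a) ∧ φ z = γ := by
  have hm0 : m ≠ 0 := by rintro rfl; simp at hm
  let ψ : F[X][X] →+* B := eval₂RingHom (algebraMap F[X] B) z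
  let π : F[X][X] →+* F := eval₂RingHom (evalRingHom a) γ
  have hker : RingHom.ker ψ ≤ RingHom.ker π := by
    intro H hH
    obtain ⟨Q, rfl⟩ := h.dvd_of_eval₂_eq_zero hm0 hm' hz hzr
      (show eval₂ (algebraMap F[X] B) z H = 0 from hH)
    rw [RingHom.mem_ker, map_mul]
    simp [π, hγ]
  let _ : Algebra F[X][X] B := ψ.toAlgebra
  have hC : ∀ q : F[X], algebraMap F[X][X] B (C q) = algebraMap F[X] B q := fun q => by
    simp [RingHom.algebraMap_toAlgebra, ψ]
  have hX : algebraMap F[X][X] B X = z := by simp [RingHom.algebraMap_toAlgebra, ψ]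
  have : IsScalarTower F[X] F[X][X] B := IsScalarTower.of_algebraMap_eq fun q => by
    rw [Polynomial.algebraMap_eq, hC]
  have : Algebra.IsIntegral F[X][X] B := ⟨fun b => (h.isIntegral b).tower_top⟩
  have hprime : (RingHom.ker π).IsPrime := RingHom.ker_isPrime π
  obtain ⟨Q, -, hQ, hQP⟩ := Ideal.exists_ideal_over_prime_of_isIntegral (RingHom.ker π)
    (⊥ : Ideal B) (fun H hH => hker (RingHom.mem_ker.mpr (Ideal.mem_bot.mp hH)))
  let φ : B →+* B ⧸ Q := Ideal.Quotient.mk Q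
  let _ : Algebra F (B ⧸ Q) := (φ.comp ((algebraMap F[X] B).comp C)).toAlgebra
  have hφ0 : ∀ H : F[X][X], π H = 0 → φ (ψ H) = 0 := fun H hH => by
    have : H ∈ Ideal.comap (algebraMap F[X][X] B) Q := by rw [hQP]; exact hH
    exact Ideal.Quotient.eq_zero_iff_mem.mpr this
  have hφ : ∀ q : F[X], φ (algebraMap F[X] B q) = algebraMap F (B ⧸ Q) (q.eval a) := fun q => by
    have := hφ0 (C q - C (C (q.eval a))) (by simp [π])
    rw [map_sub, map_sub, sub_eq_zero] at this
    simpa [ψ, RingHom.algebraMap_toAlgebra] using this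
  have hφz : φ z = algebraMap F (B ⧸ Q) γ := by
    have := hφ0 (X - C (C γ)) (by simp [π])
    rw [map_sub, map_sub, sub_eq_zero] at this
    simpa [ψ, RingHom.algebraMap_toAlgebra] using this
  have hsurj : Function.Surjective (algebraMap F (B ⧸ Q)) := by
    intro w
    obtain ⟨b, rfl⟩ := Ideal.Quotient.mk_surjective w
    obtain ⟨P, hP⟩ := h.exists_apply_eq_aeval hinj hm hf hg hm' hs' hcop hz b
    refine ⟨P.eval γ, ?_⟩
    have h1 := hP (B ⧸ Q) φ hφ
    rw [hφz, aeval_algebraMap_apply_eq_algebraMap_eval] at h1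
    exact h1.symm
  let ε : F ≃+* B ⧸ Q := RingEquiv.ofBijective (algebraMap F (B ⧸ Q))
    ⟨(algebraMap F (B ⧸ Q)).injective, hsurj⟩
  refine ⟨ε.symm.toRingHom.comp φ, fun q => ?_, ?_⟩
  · change ε.symm (φ _) = _
    rw [hφ, RingEquiv.symm_apply_eq]
    rfl
  · change ε.symm (φ _) = _
    rw [hφz, RingEquiv.symm_apply_eq]
    rfl

/-- The number of rational points over `x = a` on the normalization of `y ^ m = (x - a) ^ s g(x)`,
`g(a) ≠ 0`, is the number of `gcd(m, s)`-th roots of `g(a)`. -/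
theorem card_points [IsAlgClosed Ω] (h : IsNormalModel m f y Ω)
    (hinj : Function.Injective (algebraMap F[X] Ω)) (hm : (m : F) ≠ 0) {a : F}
    {s : ℕ} {g : F[X]} (hf : f = (X - C a) ^ s * g) (hg : g.eval a ≠ 0) :
    Nat.card {φ : B →+* F // ∀ q : F[X], φ (algebraMap F[X] B q) = q.eval a} =
      Nat.card {γ : F // γ ^ m.gcd s = g.eval a} := by
  have hm0 : m ≠ 0 := by rintro rfl; simp at hm
  have ht : (X - C a : F[X]) ≠ 0 := X_sub_C_ne_zero a
  obtain ⟨m', s', hcop, hm', hs'⟩ := Nat.exists_coprime m s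
  set r := m.gcd s with hr
  have hr0 : 0 < r := Nat.gcd_pos_of_pos_left s (Nat.pos_of_ne_zero hm0)
  rw [mul_comm] at hm' hs'
  have hyr : (y ^ m') ^ r = ((X - C a) ^ s') ^ r • algebraMap F[X] B g := by
    rw [← pow_mul, mul_comm m', ← hm', h.pow_eq, hf, Algebra.smul_def, ← map_mul, ← pow_mul,
      mul_comm s', ← hs']
  obtain ⟨z, hz⟩ := h.exists_eq_smul _ (pow_ne_zero s' ht) (y ^ m') _ r hr0 hyr
  have hzr : z ^ r = algebraMap F[X] B g := by
    refine h.smul_left_cancel (pow_ne_zero r (pow_ne_zero s' ht)) ?_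
    rw [← hyr, hz, _root_.smul_pow]
  refine Nat.card_congr (Equiv.ofBijective (fun φ => ⟨φ.1 z, ?_⟩) ⟨?_, ?_⟩)
  · rw [← map_pow, hzr, φ.2]
  · intro φ₁ φ₂ h12
    have h12 : φ₁.1 z = φ₂.1 z := congrArg Subtype.val h12
    ext b
    obtain ⟨P, hP⟩ := h.exists_apply_eq_aeval hinj hm hf hg hm' hs' hcop hz.symm b
    rw [hP F φ₁.1 φ₁.2, hP F φ₂.1 φ₂.2, h12]
  · rintro ⟨γ, hγ⟩
    obtain ⟨φ, hφ, hφz⟩ := h.exists_algHom hinj hm hf hg hm' hs' hcop hz.symm hzr hγ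
    exact ⟨⟨φ, hφ⟩, Subtype.ext hφz⟩

end IsNormalModel

end NormalModel

/-! ### The normalization of a superelliptic curve -/

section Normalization

variable {F : Type*} [Field F] {m : ℕ} {f : F[X]}

namespace CoordRing

/-- The coordinate function `y`. -/
noncomputable abbrev y (m : ℕ) (f : F[X]) : CoordRing m f := AdjoinRoot.root (eqn m f)

lemma y_pow (m : ℕ) (f : F[X]) : y m f ^ m = algebraMap F[X] (CoordRing m f) f := by
  have h := AdjoinRoot.mk_self (f := eqn m f)
  rw [map_sub, map_pow, AdjoinRoot.mk_X, AdjoinRoot.mk_C, sub_eq_zero] at h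
  exact h

lemma natDegree_eqn (m : ℕ) (f : F[X]) : (eqn m f).natDegree = m := natDegree_X_pow_sub_C

lemma monic_eqn (hm : m ≠ 0) (f : F[X]) : (eqn m f).Monic := monic_X_pow_sub_C f hm

lemma mk_eq_sum {p : F[X][X]} (hp : p.natDegree < m) :
    AdjoinRoot.mk (eqn m f) p = ∑ i ∈ Finset.range m, p.coeff i • y m f ^ i := by
  conv_lhs => rw [p.as_sum_range' m hp]
  rw [map_sum]
  refine Finset.sum_congr rfl fun i _ => ?_
  rw [← C_mul_X_pow_eq_monomial, map_mul, map_pow, AdjoinRoot.mk_X, AdjoinRoot.mk_C,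
    Algebra.smul_def]
  rfl

lemma exists_eq_sum (hm : m ≠ 0) (u : CoordRing m f) :
    ∃ c : ℕ → F[X], u = ∑ i ∈ Finset.range m, c i • y m f ^ i := by
  obtain ⟨p, rfl⟩ := AdjoinRoot.mk_surjective u
  have hmon := monic_eqn hm f
  refine ⟨(p %ₘ eqn m f).coeff, ?_⟩
  rw [← mk_eq_sum]
  · conv_lhs => rw [← modByMonic_add_div p (eqn m f)]
    rw [map_add, map_mul, AdjoinRoot.mk_self, zero_mul, add_zero]
  · have := natDegree_modByMonic_lt p hmon (by
      intro h1
      have := congrArg natDegree h1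
      rw [natDegree_eqn, natDegree_one] at this
      exact hm this)
    rwa [natDegree_eqn] at this

lemma indep (hm : m ≠ 0) (c : ℕ → F[X]) (hc : ∑ i ∈ Finset.range m, c i • y m f ^ i = 0) :
    ∀ i < m, c i = 0 := by
  have hmon := monic_eqn hm f
  set p : F[X][X] := ∑ i ∈ Finset.range m, C (c i) * X ^ i with hp
  have hcoeff : ∀ i, p.coeff i = if i < m then c i else 0 := fun i => by
    simp [hp, finsetSum_coeff, coeff_C_mul, coeff_X_pow]
  have hdeg : p.degree < m := by
    rw [degree_lt_iff_coeff_zero]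
    intro i hi
    rw [hcoeff, if_neg (by omega)]
  have h0 : p = 0 := by
    refine eq_zero_of_dvd_of_degree_lt (p := eqn m f) ?_ ?_
    · rw [← AdjoinRoot.mk_eq_zero, ← hc, hp, map_sum]
      refine Finset.sum_congr rfl fun i _ => ?_
      rw [map_mul, map_pow, AdjoinRoot.mk_X, AdjoinRoot.mk_C, Algebra.smul_def]
      rfl
    · rw [degree_eq_natDegree hmon.ne_zero, natDegree_eqn]
      exact hdeg
  intro i hi
  have := hcoeff i
  rw [if_pos hi, h0, coeff_zero] at this
  exact this.symm

lemma smul_eq_zero_imp (hm : m ≠ 0) {p : F[X]} (hp : p ≠ 0) {u : CoordRing m f} (h : p • u = 0) :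
    u = 0 := by
  obtain ⟨c, rfl⟩ := exists_eq_sum hm u
  rw [Finset.smul_sum] at h
  simp_rw [smul_smul] at h
  refine Finset.sum_eq_zero fun i hi => ?_
  have := indep hm _ h i (Finset.mem_range.mp hi)
  rw [(mul_eq_zero.mp this).resolve_left hp, zero_smul]

lemma isIntegral (hm : m ≠ 0) (u : CoordRing m f) : IsIntegral F[X] u := by
  obtain ⟨c, rfl⟩ := exists_eq_sum hm u
  refine IsIntegral.sum _ fun i _ => (IsIntegral.pow ?_ i).smul (c i)
  exact IsIntegral.of_pow (Nat.pos_of_ne_zero hm) (by rw [y_pow]; exact isIntegral_algebraMap)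

end CoordRing

/-- Every rational function on the curve is a regular function divided by a polynomial in `x`. -/
lemma exists_smul_eq_algebraMap (hm : m ≠ 0) (b : FractionRing (CoordRing m f)) :
    ∃ p : F[X], p ≠ 0 ∧ ∃ u : CoordRing m f, p • b = algebraMap _ _ u := by
  obtain ⟨⟨u, w⟩, hb⟩ := IsLocalization.surj (nonZeroDivisors (CoordRing m f)) b
  obtain ⟨c, d, hd, hdc⟩ := IsAlgebraic.exists_smul_eq_mul (R := F[X]) u
    (CoordRing.isIntegral hm w.1).isAlgebraic w.2
  refine ⟨d, hd, c, ?_⟩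
  have hw : IsUnit (algebraMap _ (FractionRing (CoordRing m f)) w.1) :=
    IsLocalization.map_units _ w
  refine hw.mul_left_cancel ?_
  rw [← map_mul, ← hdc, mul_smul_comm, mul_comm, hb, Algebra.smul_def, Algebra.smul_def, map_mul,
    ← IsScalarTower.algebraMap_apply]

lemma smul_fraction_eq_zero_imp (hm : m ≠ 0) {p : F[X]} (hp : p ≠ 0)
    {b : FractionRing (CoordRing m f)} (h : p • b = 0) : b = 0 := by
  obtain ⟨⟨u, w⟩, hb⟩ := IsLocalization.surj (nonZeroDivisors (CoordRing m f)) b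
  have hw : IsUnit (algebraMap _ (FractionRing (CoordRing m f)) w.1) :=
    IsLocalization.map_units _ w
  have hu : u = 0 := by
    refine CoordRing.smul_eq_zero_imp hm hp
      (IsFractionRing.injective (CoordRing m f) (FractionRing (CoordRing m f)) ?_)
    rw [map_zero, Algebra.smul_def, map_mul, ← hb, ← mul_assoc, ← IsScalarTower.algebraMap_apply,
      ← Algebra.smul_def, h, zero_mul]
  rw [hu, map_zero] at hb
  exact hw.mul_left_eq_zero.mp hb

/-- A nonzero polynomial in `x` is invertible as a rational function on the curve. -/
lemma isUnit_algebraMap_fraction (hm : m ≠ 0) {p : F[X]} (hp : p ≠ 0) :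
    IsUnit (algebraMap F[X] (FractionRing (CoordRing m f)) p) := by
  rw [IsScalarTower.algebraMap_apply F[X] (CoordRing m f)]
  refine IsLocalization.map_units _ (⟨_, ?_⟩ : nonZeroDivisors (CoordRing m f))
  rw [mem_nonZeroDivisors_iff_right]
  intro u hu
  refine CoordRing.smul_eq_zero_imp hm hp ?_
  rw [Algebra.smul_def, mul_comm, hu]

/-- A map `F[x] → Ω` together with an `m`-th root of `f` in `Ω` extends to all rational functions
on the curve. -/
lemma exists_fraction_algHom (hm : m ≠ 0) {Ω : Type*} [Field Ω] [Algebra F[X] Ω]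
    (hinj : Function.Injective (algebraMap F[X] Ω)) {η : Ω} (hη : η ^ m = algebraMap F[X] Ω f) :
    ∃ σ : FractionRing (CoordRing m f) →ₐ[F[X]] Ω,
      σ (algebraMap _ _ (CoordRing.y m f)) = η := by
  let σ₀ : CoordRing m f →ₐ[F[X]] Ω := AdjoinRoot.liftAlgHom (eqn m f) (Algebra.ofId F[X] Ω) η (by
    rw [eval₂_sub, eval₂_X_pow, eval₂_C, hη, sub_eq_zero]
    rfl)
  have hσ₀ : ∀ w : nonZeroDivisors (CoordRing m f), IsUnit (σ₀ w) := by
    intro w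
    obtain ⟨c, d, hd, hdc⟩ := IsAlgebraic.exists_smul_eq_mul (R := F[X]) 1
      (CoordRing.isIntegral hm w.1).isAlgebraic w.2
    refine IsUnit.mk0 _ fun h0 => hd (hinj ?_)
    have := congrArg σ₀ hdc
    rw [map_smul, map_mul, h0, zero_mul, map_one, Algebra.smul_def, mul_one] at this
    rw [this, map_zero]
  refine ⟨IsLocalization.liftAlgHom (M := nonZeroDivisors (CoordRing m f)) (f := σ₀) hσ₀, ?_⟩
  rw [IsLocalization.liftAlgHom_apply, IsLocalization.lift_eq]
  simp [σ₀]

lemma algebraMap_normRing_injective (m : ℕ) (f : F[X]) :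
    Function.Injective (algebraMap (CoordRing m f) (NormRing m f)) := fun _ _ h =>
  IsFractionRing.injective (CoordRing m f) (FractionRing (CoordRing m f))
    (congrArg Subtype.val h)

lemma smul_normRing_eq_zero_imp (hm : m ≠ 0) {p : F[X]} (hp : p ≠ 0)
    {b : NormRing m f} (h : p • b = 0) : b = 0 :=
  Subtype.ext (smul_fraction_eq_zero_imp hm hp (congrArg Subtype.val h))

lemma exists_smul_eq_algebraMap_normRing (hm : m ≠ 0) (b : NormRing m f) :
    ∃ p : F[X], p ≠ 0 ∧ ∃ u : CoordRing m f, p • b = algebraMap _ (NormRing m f) u := by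
  obtain ⟨p, hp, u, hu⟩ := exists_smul_eq_algebraMap hm b.1
  exact ⟨p, hp, u, Subtype.ext hu⟩

lemma isNormalModel_normRing (hm : m ≠ 0) {Ω : Type*} [Field Ω] [Algebra F[X] Ω]
    (hinj : Function.Injective (algebraMap F[X] Ω)) :
    IsNormalModel m f (algebraMap _ (NormRing m f) (CoordRing.y m f)) Ω where
  pow_eq := by rw [← map_pow, CoordRing.y_pow, ← IsScalarTower.algebraMap_apply]
  smul_cancel p hp b h := smul_normRing_eq_zero_imp hm hp h
  exists_smul_eq_sum b := by
    obtain ⟨p, hp, u, hu⟩ := exists_smul_eq_algebraMap_normRing hm b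
    obtain ⟨c, hc⟩ := CoordRing.exists_eq_sum hm u
    refine ⟨p, hp, c, ?_⟩
    rw [hu, hc, map_sum]
    refine Finset.sum_congr rfl fun i _ => ?_
    rw [Algebra.smul_def, Algebra.smul_def, map_mul, map_pow, ← IsScalarTower.algebraMap_apply]
  indep c hc := by
    refine CoordRing.indep (f := f) hm c (algebraMap_normRing_injective m f ?_)
    rw [map_zero, ← hc, map_sum]
    refine Finset.sum_congr rfl fun i _ => ?_
    rw [Algebra.smul_def, Algebra.smul_def, map_mul, map_pow, ← IsScalarTower.algebraMap_apply]
  isIntegral b := by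
    have : Algebra.IsIntegral F[X] (CoordRing m f) := ⟨CoordRing.isIntegral hm⟩
    have h1 : IsIntegral (CoordRing m f) b := Algebra.IsIntegral.isIntegral b
    exact isIntegral_trans b h1
  exists_eq_smul p hp b c j hj h := by
    have hu := isUnit_algebraMap_fraction (f := f) hm hp
    obtain ⟨w, hw⟩ := hu
    have h1 : (↑w⁻¹ * (b : FractionRing (CoordRing m f))) ^ j = c := by
      have h2 : (b : FractionRing (CoordRing m f)) ^ j =
          (algebraMap F[X] (FractionRing (CoordRing m f)) p) ^ j * c := by
        rw [← map_pow, ← Algebra.smul_def]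
        exact congrArg Subtype.val h
      rw [mul_pow, h2, ← hw, ← mul_assoc, ← mul_pow, Units.inv_mul, one_pow, one_mul]
    have h3 : IsIntegral (CoordRing m f) (↑w⁻¹ * (b : FractionRing (CoordRing m f))) :=
      IsIntegral.of_pow hj (h1 ▸ c.2)
    refine ⟨⟨_, h3⟩, Subtype.ext ?_⟩
    change (b : FractionRing (CoordRing m f)) = p • (↑w⁻¹ * (b : FractionRing (CoordRing m f)))
    rw [Algebra.smul_def, ← hw, Units.mul_inv_cancel_left]
  exists_hom η hη := by
    obtain ⟨σ, hσ⟩ := exists_fraction_algHom hm hinj hη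
    exact ⟨σ.comp ((integralClosure (CoordRing m f)
      (FractionRing (CoordRing m f))).val.restrictScalars F[X]), hσ⟩

/-- The number of `F`-points of the normalization over `x = a` is the number of `gcd(m, s)`-th
roots of `g(a)`, where `f = (x - a) ^ s g(x)` with `g(a) ≠ 0`. -/
theorem numPointsNorm_eq (hm : (m : F) ≠ 0) {a : F} {s : ℕ} {g : F[X]}
    (hf : f = (X - C a) ^ s * g) (hg : g.eval a ≠ 0) :
    numPointsNorm m f a = Nat.card {γ : F // γ ^ m.gcd s = g.eval a} := by
  have hm0 : m ≠ 0 := by rintro rfl; simp at hm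
  have hinj : Function.Injective (algebraMap F[X] (AlgebraicClosure (FractionRing F[X]))) := by
    rw [IsScalarTower.algebraMap_eq F[X] (FractionRing F[X])]
    exact (algebraMap (FractionRing F[X]) _).injective.comp (IsFractionRing.injective _ _)
  rw [← (isNormalModel_normRing (f := f) hm0 hinj).card_points hinj hm hf hg]
  have hx : xCoord m f = algebraMap F[X] (NormRing m f) X := rfl
  have hcomm : ∀ u : F, algebraMap F[X] (NormRing m f) (C u) = algebraMap F (NormRing m f) u :=
    fun u => rfl
  refine Nat.card_congr ⟨fun φ => ⟨φ.1.toRingHom, fun q => ?_⟩,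
    fun φ => ⟨{ φ.1 with commutes' := fun u => ?_ }, ?_⟩, fun φ => ?_, fun φ => ?_⟩
  · have h1 : φ.1 (algebraMap F[X] (NormRing m f) X) = a := hx ▸ φ.2
    change φ.1 (algebraMap F[X] (NormRing m f) q) = _
    induction q using Polynomial.induction_on' with
    | add p q hp hq => rw [map_add, map_add, hp, hq, eval_add]
    | monomial i u =>
      rw [← C_mul_X_pow_eq_monomial, map_mul, map_pow, map_mul, map_pow, h1, hcomm,
        AlgHom.commutes, eval_mul, eval_pow, eval_C, eval_X]
      rfl
  · change φ.1 (algebraMap F (NormRing m f) u) = u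
    rw [← hcomm, φ.2, eval_C]
  · change φ.1 (xCoord m f) = a
    rw [hx, φ.2, eval_X]
  · rfl
  · rfl

end Normalization

/-! ### Irreducibility -/

section Irreducibility

variable {F : Type*} [Field F] {m : ℕ} {f : F[X]}

/-- Eisenstein's criterion at a simple prime factor of `f`. -/
lemma irreducible_eqn (hm : m ≠ 0) {p : F[X]} (hp : Prime p) (hpf : p ∣ f) (hpf2 : ¬ p ^ 2 ∣ f) :
    Irreducible (eqn m f) := by
  have hmon := CoordRing.monic_eqn hm f
  have hnd := CoordRing.natDegree_eqn m f
  have hcoeff : ∀ i, i < m → (eqn m f).coeff i = if i = 0 then -f else 0 := by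
    intro i hi
    rw [coeff_sub, coeff_X_pow, coeff_C, if_neg hi.ne]
    split_ifs <;> simp
  have hP : (Ideal.span {p}).IsPrime := (Ideal.span_singleton_prime hp.ne_zero).mpr hp
  refine irreducible_of_eisenstein_criterion hP ?_ ?_ ?_ ?_ hmon.isPrimitive
  · rw [hmon.leadingCoeff]
    exact fun h => hP.ne_top ((Ideal.eq_top_iff_one _).mpr h)
  · intro i hi
    have hi : i < m := by
      rw [degree_eq_natDegree hmon.ne_zero, hnd] at hi
      exact_mod_cast hi
    rw [hcoeff i hi, Ideal.mem_span_singleton]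
    split_ifs
    · exact (dvd_neg).mpr hpf
    · exact dvd_zero _
  · rw [← natDegree_pos_iff_degree_pos, hnd]
    exact Nat.pos_of_ne_zero hm
  · rw [hcoeff 0 (Nat.pos_of_ne_zero hm), if_pos rfl, Ideal.span_singleton_pow,
      Ideal.mem_span_singleton, dvd_neg]
    exact hpf2

/-- Over a perfect field a simple irreducible factor splits into simple linear factors over the
algebraic closure, so Eisenstein's criterion applies there too. -/
lemma curveGeomIrred_of_dvd [PerfectField F] (hm : m ≠ 0) {p : F[X]} (hp : Irreducible p)
    (hpf : p ∣ f) (hpf2 : ¬ p ^ 2 ∣ f) : CurveGeomIrred m f := by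
  obtain ⟨h, rfl⟩ := hpf
  have hph : ¬ p ∣ h := fun hd => hpf2 (by rw [sq]; exact mul_dvd_mul_left p hd)
  have hcop : IsCoprime p h := (Irreducible.coprime_iff_not_dvd hp).mpr hph
  set ι := algebraMap F (AlgebraicClosure F)
  have hcop' : IsCoprime (p.map ι) (h.map ι) := hcop.map (mapRingHom ι)
  have hsep : (p.map ι).Separable := (PerfectField.separable_of_irreducible hp).map
  obtain ⟨α, hα⟩ := IsAlgClosed.exists_root (p.map ι) (by
    rw [degree_map]
    exact (degree_pos_of_irreducible hp).ne')
  have hdvd : X - C α ∣ p.map ι := dvd_iff_isRoot.mpr hα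
  refine irreducible_eqn hm (prime_X_sub_C α) ?_ ?_
  · rw [Polynomial.map_mul]
    exact hdvd.mul_right _
  · rw [Polynomial.map_mul]
    intro h2
    have h3 : IsCoprime ((X - C α) ^ 2) (h.map ι) := (hcop'.of_isCoprime_of_dvd_left hdvd).pow_left
    have h4 := h3.dvd_of_dvd_mul_right h2
    rw [sq] at h4
    exact not_isUnit_X_sub_C α (hsep.squarefree _ h4)

lemma isDomain_coordRing (h : CurveIrred m f) : IsDomain (CoordRing m f) :=
  AdjoinRoot.isDomain_of_prime h.prime

lemma normIrred_of_curveIrred (h : CurveIrred m f) : NormIrred m f := by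
  have := isDomain_coordRing h
  have : IsDomain (NormRing m f) := inferInstance
  exact (inferInstance : IrreducibleSpace (PrimeSpectrum (NormRing m f)))

lemma prime_map_of_equiv {R S : Type*} [CommRing R] [CommRing S] (e : R ≃+* S) {p : R[X]}
    (hp : Prime p) : Prime (mapRingHom e.toRingHom p) :=
  (MulEquiv.prime_iff (mapEquiv e)).mpr hp

lemma isDomain_tensor_coordRing (h : CurveGeomIrred m f) :
    IsDomain (AlgebraicClosure F ⊗[F] CoordRing m f) := by
  set k := AlgebraicClosure F
  let q : (k ⊗[F] F[X])[X] := (eqn m f).map Algebra.TensorProduct.includeRight.toRingHom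
  let e : k[X] ≃+* k ⊗[F] F[X] := (polyEquivTensor F k).toRingEquiv
  have he : ∀ g : F[X], e (g.map (algebraMap F k)) = 1 ⊗ₜ g := by
    intro g
    change polyEquivTensor F k _ = _
    rw [← AlgEquiv.eq_symm_apply, polyEquivTensor_symm_apply_tmul_eq_smul, one_smul]
  have hq : mapRingHom e.toRingHom (eqn m (f.map (algebraMap F k))) = q := by
    simp [q, eqn, he]
  have hprime : Prime q := by
    rw [← hq]
    exact prime_map_of_equiv e h.prime
  have := AdjoinRoot.isDomain_of_prime hprime
  exact (AdjoinRoot.tensorAlgEquiv (R := F) (T := k) (eqn m f) q rfl).toMulEquiv.isDomain _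

/-- Being a domain after a flat base change passes from `S` to an extension `B` whose elements are
fractions of elements of `S` with regular denominators. -/
lemma isDomain_tensor_of_denominators (k : Type*) [Field k] [Algebra F k] {S B : Type*}
    [CommRing S] [Algebra F S] [CommRing B] [Algebra F B] {j : S →ₐ[F] B}
    (hj : Function.Injective j)
    (hden : ∀ b : B, ∃ d : S, (∀ b' : B, j d * b' = 0 → b' = 0) ∧ ∃ u : S, j d * b = j u)
    [IsDomain (k ⊗[F] S)] : IsDomain (k ⊗[F] B) := by
  let J : k ⊗[F] S →ₐ[k] k ⊗[F] B := Algebra.TensorProduct.map (AlgHom.id k k) j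
  have hJ : Function.Injective J :=
    Module.Flat.lTensor_preserves_injective_linearMap (M := k) j.toLinearMap hj
  have hreg : ∀ d : S, (∀ b' : B, j d * b' = 0 → b' = 0) → ∀ u : k ⊗[F] B,
      J (1 ⊗ₜ d) * u = 0 → u = 0 := by
    intro d hd u hu
    have hinj := Module.Flat.lTensor_preserves_injective_linearMap (M := k)
      (LinearMap.mulLeft F (j d)) ((injective_iff_map_eq_zero _).mpr hd)
    refine (injective_iff_map_eq_zero _).mp hinj u ?_
    rw [← hu]
    clear hu
    induction u with
    | zero => simp
    | add u v hu hv => rw [map_add, hu, hv, mul_add]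
    | tmul c b => simp [J]
  have hex : ∀ u : k ⊗[F] B, ∃ d : S, (∀ b' : B, j d * b' = 0 → b' = 0) ∧
      ∃ v : k ⊗[F] S, J (1 ⊗ₜ d) * u = J v := by
    intro u
    induction u with
    | zero => exact ⟨1, by simp, 0, by simp⟩
    | add u v hu hv =>
      obtain ⟨p, hp, u', hu⟩ := hu
      obtain ⟨q, hq, v', hv⟩ := hv
      refine ⟨p * q, fun b' hb' => hq b' (hp _ (by rwa [← mul_assoc, ← map_mul])),
        (1 ⊗ₜ q) * u' + (1 ⊗ₜ p) * v', ?_⟩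
      have h1 : (1 : k) ⊗ₜ[F] (p * q) = (1 ⊗ₜ p) * (1 ⊗ₜ q) := by
        rw [Algebra.TensorProduct.tmul_mul_tmul, one_mul]
      rw [h1, map_add, map_mul, map_mul, map_mul, ← hu, ← hv]
      ring
    | tmul c b =>
      obtain ⟨p, hp, v, hv⟩ := hden b
      refine ⟨p, hp, c ⊗ₜ v, ?_⟩
      simp [J, hv]
  have : Nontrivial (k ⊗[F] B) := hJ.nontrivial
  have : NoZeroDivisors (k ⊗[F] B) := ⟨by
    intro u v huv
    obtain ⟨p, hp, u', hu⟩ := hex u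
    obtain ⟨q, hq, v', hv⟩ := hex v
    have h0 : u' * v' = 0 := hJ (by
      rw [map_mul, ← hu, ← hv, mul_mul_mul_comm, huv, mul_zero, map_zero])
    rcases mul_eq_zero.mp h0 with h0 | h0
    · exact Or.inl (hreg p hp u (by rw [hu, h0, map_zero]))
    · exact Or.inr (hreg q hq v (by rw [hv, h0, map_zero]))⟩
  exact NoZeroDivisors.to_isDomain _

lemma normGeomIrred_of_curveGeomIrred (hm : m ≠ 0) (h : CurveGeomIrred m f) :
    NormGeomIrred m f := by
  have := isDomain_tensor_coordRing h
  have : IsDomain (AlgebraicClosure F ⊗[F] NormRing m f) := by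
    refine isDomain_tensor_of_denominators (AlgebraicClosure F)
      (j := IsScalarTower.toAlgHom F (CoordRing m f) (NormRing m f))
      (algebraMap_normRing_injective m f) fun b => ?_
    obtain ⟨p, hp, v, hv⟩ := exists_smul_eq_algebraMap_normRing hm b
    have h1 : ∀ b' : NormRing m f, IsScalarTower.toAlgHom F (CoordRing m f) (NormRing m f)
        (algebraMap F[X] (CoordRing m f) p) * b' = p • b' := fun b' => by
      rw [Algebra.smul_def]
      rfl
    exact ⟨algebraMap F[X] (CoordRing m f) p,
      fun b' hb' => smul_normRing_eq_zero_imp hm hp (by rw [← h1, hb']), v, by rw [h1, hv]; rfl⟩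
  exact (inferInstance : IrreducibleSpace (PrimeSpectrum (AlgebraicClosure F ⊗[F] NormRing m f)))

end Irreducibility

/-! ### Counting polynomials with a square factor -/

section Counting

variable {F : Type*} [Field F]

lemma C_add_X_mul_injective :
    Function.Injective (fun x : F × F[X] => C x.1 + X * x.2) := by
  rintro ⟨c, g⟩ ⟨c', g'⟩ h
  have h0 := congrArg (fun p : F[X] => p.coeff 0) h
  simp only [coeff_add, coeff_C_zero, mul_coeff_zero, coeff_X_zero, zero_mul, add_zero] at h0
  subst h0
  simpa using h

lemma ncard_C_add_X_mul (S : Set F) (T : Set F[X]) :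
    ((fun x : F × F[X] => C x.1 + X * x.2) '' S ×ˢ T).ncard = S.ncard * T.ncard := by
  rw [Set.ncard_image_of_injective _ C_add_X_mul_injective, Set.ncard_prod]

lemma eq_C_add_X_mul (f : F[X]) : C (f.coeff 0) + X * f.divX = f := by
  rw [add_comm, mul_comm]
  exact divX_mul_X_add f

lemma degree_eq_succ_set (d : ℕ) : {f : F[X] | f.degree = ((d + 1 : ℕ) : WithBot ℕ)} =
    (fun x : F × F[X] => C x.1 + X * x.2) '' Set.univ ×ˢ {f : F[X] | f.degree = d} := by
  have key : ∀ (c : F) (g : F[X]),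
      (C c + X * g).degree = ((d + 1 : ℕ) : WithBot ℕ) ↔ g.degree = d := by
    intro c g
    rw [degree_eq_iff_natDegree_eq_of_pos d.succ_pos]
    by_cases hg : g = 0
    · simp [hg]
    · rw [natDegree_C_add, natDegree_X_mul hg, degree_eq_natDegree hg]
      simp
  ext f
  simp only [Set.mem_ofPred_eq, Set.mem_image, Set.mem_prod, Set.mem_univ, true_and, Prod.exists]
  constructor
  · intro hf
    exact ⟨f.coeff 0, f.divX, (key (f.coeff 0) _).mp (by rwa [eq_C_add_X_mul]), eq_C_add_X_mul f⟩
  · rintro ⟨c, g, hg, rfl⟩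
    exact (key c g).mpr hg

lemma monic_natDegree_C_add_X_mul (c : F) (g : F[X]) (d : ℕ) :
    (C c + X * g).Monic ∧ (C c + X * g).natDegree = d + 1 ↔ g.Monic ∧ g.natDegree = d := by
  by_cases hg : g = 0
  · subst hg
    simp [Monic]
  · have h1 : (C c + X * g).leadingCoeff = g.leadingCoeff := by
      rw [leadingCoeff_add_of_degree_lt, leadingCoeff_mul, leadingCoeff_X, one_mul]
      refine degree_C_le.trans_lt ?_
      rw [degree_mul, degree_X, degree_eq_natDegree hg]
      exact_mod_cast Nat.add_pos_left one_pos _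
    rw [Monic, h1, natDegree_C_add, natDegree_X_mul hg, Monic, Nat.add_right_cancel_iff]

variable [Fintype F]

lemma finite_degree_eq (d : ℕ) : {f : F[X] | f.degree = d}.Finite := by
  induction d with
  | zero =>
    refine (Set.finite_range (C : F → F[X])).subset fun f hf => ?_
    exact ⟨f.coeff 0, (eq_C_of_degree_le_zero (le_of_eq hf)).symm⟩
  | succ d ih =>
    rw [degree_eq_succ_set]
    exact (Set.finite_univ.prod ih).image _

lemma ncard_degree_eq (d : ℕ) : {f : F[X] | f.degree = d}.ncard =
    (Fintype.card F - 1) * Fintype.card F ^ d := by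
  induction d with
  | zero =>
    have : {f : F[X] | f.degree = ((0 : ℕ) : WithBot ℕ)} = C '' {0}ᶜ := by
      ext f
      simp only [Set.mem_ofPred_eq, Nat.cast_zero, Set.mem_image, Set.mem_compl_iff,
        Set.mem_singleton_iff]
      constructor
      · intro hf
        have h := eq_C_of_degree_le_zero hf.le
        refine ⟨f.coeff 0, fun h0 => ?_, h.symm⟩
        rw [h, h0] at hf
        simp at hf
      · rintro ⟨c, hc, rfl⟩
        exact degree_C hc
    rw [this, Set.ncard_image_of_injective _ C_injective, Set.ncard_compl, Set.ncard_singleton,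
      Nat.card_eq_fintype_card, pow_zero, mul_one]
  | succ d ih =>
    rw [degree_eq_succ_set, ncard_C_add_X_mul, ih, Set.ncard_univ, Nat.card_eq_fintype_card]
    ring

lemma ncard_monic_natDegree_eq (d : ℕ) : {f : F[X] | f.Monic ∧ f.natDegree = d}.ncard =
    Fintype.card F ^ d := by
  induction d with
  | zero =>
    have : {f : F[X] | f.Monic ∧ f.natDegree = 0} = {1} := by
      ext f
      simp only [Set.mem_ofPred_eq, Set.mem_singleton_iff]
      constructor
      · rintro ⟨h1, h2⟩
        exact eq_one_of_monic_natDegree_zero h1 h2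
      · rintro rfl
        simp
    rw [this, Set.ncard_singleton, pow_zero]
  | succ d ih =>
    have : {f : F[X] | f.Monic ∧ f.natDegree = d + 1} =
        (fun x : F × F[X] => C x.1 + X * x.2) ''
          Set.univ ×ˢ {f : F[X] | f.Monic ∧ f.natDegree = d} := by
      ext f
      simp only [Set.mem_ofPred_eq, Set.mem_image, Set.mem_prod, Set.mem_univ, true_and,
        Prod.exists]
      constructor
      · intro hf
        exact ⟨f.coeff 0, f.divX, (monic_natDegree_C_add_X_mul (f.coeff 0) _ _).mp
          (by rwa [eq_C_add_X_mul]), eq_C_add_X_mul f⟩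
      · rintro ⟨c, g, hg, rfl⟩
        exact (monic_natDegree_C_add_X_mul c g d).mpr hg
    rw [this, ncard_C_add_X_mul, ih, Set.ncard_univ, Nat.card_eq_fintype_card]
    ring

lemma ncard_monic_natDegree_eq_coeff_zero_ne (d : ℕ) :
    {f : F[X] | f.Monic ∧ f.natDegree = d + 1 ∧ f.coeff 0 ≠ 0}.ncard =
    (Fintype.card F - 1) * Fintype.card F ^ d := by
  have : {f : F[X] | f.Monic ∧ f.natDegree = d + 1 ∧ f.coeff 0 ≠ 0} =
      (fun x : F × F[X] => C x.1 + X * x.2) ''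
        ({0}ᶜ : Set F) ×ˢ {f : F[X] | f.Monic ∧ f.natDegree = d} := by
    ext f
    simp only [Set.mem_ofPred_eq, Set.mem_image, Set.mem_prod, Set.mem_compl_iff,
      Set.mem_singleton_iff, Prod.exists]
    constructor
    · rintro ⟨h1, h2, h3⟩
      exact ⟨f.coeff 0, f.divX, ⟨h3, (monic_natDegree_C_add_X_mul (f.coeff 0) _ _).mp
        (by rw [eq_C_add_X_mul]; exact ⟨h1, h2⟩)⟩, eq_C_add_X_mul f⟩
    · rintro ⟨c, g, ⟨hc, hg⟩, rfl⟩
      have := (monic_natDegree_C_add_X_mul c g d).mpr hg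
      exact ⟨this.1, this.2, by simpa using hc⟩
  rw [this, ncard_C_add_X_mul, ncard_monic_natDegree_eq, Set.ncard_compl, Set.ncard_singleton,
    Nat.card_eq_fintype_card]

/-- The number of polynomials of degree `d` that are divisible by the square of a member of a
given family of monic polynomials, bounded by summing over the members. -/
lemma ncard_sq_dvd_le (d : ℕ) (I : Finset ℕ) (T : ℕ → Set F[X])
    (hT : ∀ j, ∀ g ∈ T j, g.Monic ∧ g.natDegree = j) :
    {f : F[X] | f.degree = d ∧ ∃ j ∈ I, ∃ g ∈ T j, g ^ 2 ∣ f}.ncard ≤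
      ∑ j ∈ I with 2 * j ≤ d,
        (T j).ncard * ((Fintype.card F - 1) * Fintype.card F ^ (d - 2 * j)) := by
  classical
  have hTfin : ∀ j, (T j).Finite := fun j =>
    (finite_degree_eq j).subset fun g hg => by
      rw [Set.mem_ofPred_eq, degree_eq_natDegree (hT j g hg).1.ne_zero, (hT j g hg).2]
  set U : ℕ → Set F[X] := fun j =>
    (fun x : F[X] × F[X] => x.1 ^ 2 * x.2) ''
      T j ×ˢ {h : F[X] | h.degree = ((d - 2 * j : ℕ) : WithBot ℕ)}
  have hUfin : ∀ j, (U j).Finite := fun j => ((hTfin j).prod (finite_degree_eq _)).image _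
  have hsub : {f : F[X] | f.degree = d ∧ ∃ j ∈ I, ∃ g ∈ T j, g ^ 2 ∣ f} ⊆
      ((I.filter fun j => 2 * j ≤ d).biUnion fun j => (hUfin j).toFinset : Finset F[X]) := by
    rintro f ⟨hf, j, hj, g, hg, h, rfl⟩
    have hfd := hf
    rw [degree_mul, degree_pow, degree_eq_natDegree (hT j g hg).1.ne_zero, (hT j g hg).2] at hfd
    have hh : h ≠ 0 := by
      rintro rfl
      simp at hf
    rw [degree_eq_natDegree hh] at hfd
    have hfd : 2 * j + h.natDegree = d := by
      rw [nsmul_eq_mul] at hfd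
      exact_mod_cast hfd
    simp only [Finset.coe_biUnion, Set.mem_iUnion, Finset.coe_filter, Set.mem_ofPred_eq,
      Set.Finite.coe_toFinset]
    refine ⟨j, ⟨hj, by omega⟩, (g, h), ⟨hg, ?_⟩, rfl⟩
    rw [Set.mem_ofPred_eq, degree_eq_natDegree hh, ← hfd, Nat.add_sub_cancel_left]
  refine (Set.ncard_le_ncard hsub (Finset.finite_toSet _)).trans ?_
  rw [Set.ncard_coe_finset]
  refine Finset.card_biUnion_le.trans (Finset.sum_le_sum fun j _ => ?_)
  rw [← Set.ncard_eq_toFinset_card _ (hUfin j)]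
  refine (Set.ncard_image_le ((hTfin j).prod (finite_degree_eq _))).trans ?_
  rw [Set.ncard_prod, ncard_degree_eq]

lemma two_le_card : (2 : ℝ) ≤ Fintype.card F := by
  exact_mod_cast (Fintype.one_lt_card : 1 < Fintype.card F)

/-- Few polynomials of degree `d` are divisible by the square of a polynomial of large degree. -/
lemma ncard_sq_dvd_large_le (M d : ℕ) :
    ({f : F[X] | f.degree = d ∧ ∃ g : F[X], g.Monic ∧ M ≤ g.natDegree ∧ g ^ 2 ∣ f}.ncard : ℝ) ≤
      2 * Fintype.card F * (Fintype.card F : ℝ)⁻¹ ^ M * (Fintype.card F : ℝ) ^ d := by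
  set q := Fintype.card F with hq
  have hq2 : (2 : ℝ) ≤ q := two_le_card
  have hq0 : (0 : ℝ) < q := by linarith
  have hinv : (q : ℝ)⁻¹ ≤ 2⁻¹ := inv_anti₀ two_pos hq2
  have h1 := ncard_sq_dvd_le d (Finset.Ico M (d + 1))
    (fun j => {g : F[X] | g.Monic ∧ g.natDegree = j}) (fun j g hg => hg)
  have hsub : {f : F[X] | f.degree = d ∧ ∃ g : F[X], g.Monic ∧ M ≤ g.natDegree ∧ g ^ 2 ∣ f} ⊆
      {f : F[X] | f.degree = d ∧ ∃ j ∈ Finset.Ico M (d + 1),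
        ∃ g ∈ {g : F[X] | g.Monic ∧ g.natDegree = j}, g ^ 2 ∣ f} := by
    rintro f ⟨hf, g, hg, hM, hdvd⟩
    refine ⟨hf, g.natDegree, Finset.mem_Ico.mpr ⟨hM, ?_⟩, g, ⟨hg, rfl⟩, hdvd⟩
    have hf0 : f ≠ 0 := by rintro rfl; simp at hf
    have := natDegree_le_of_dvd hdvd hf0
    rw [natDegree_pow, natDegree_eq_of_degree_eq_some hf] at this
    omega
  have h2 := (Set.ncard_le_ncard hsub ((finite_degree_eq d).subset fun f hf => hf.1)).trans h1
  have h3 : ({f : F[X] | f.degree = d ∧ ∃ g : F[X], g.Monic ∧ M ≤ g.natDegree ∧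
      g ^ 2 ∣ f}.ncard : ℝ) ≤ _ := Nat.cast_le.mpr h2
  refine h3.trans ?_
  rw [Nat.cast_sum]
  have h4 : ∀ j ∈ (Finset.Ico M (d + 1)).filter (fun j => 2 * j ≤ d),
      ((({g : F[X] | g.Monic ∧ g.natDegree = j}.ncard * ((q - 1) * q ^ (d - 2 * j)) : ℕ)) : ℝ) ≤
        q * (q : ℝ) ^ d * (q : ℝ)⁻¹ ^ j := by
    intro j hj
    rw [Finset.mem_filter] at hj
    rw [ncard_monic_natDegree_eq]
    calc ((q ^ j * ((q - 1) * q ^ (d - 2 * j)) : ℕ) : ℝ)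
        ≤ ((q ^ j * (q * q ^ (d - 2 * j)) : ℕ) : ℝ) :=
          by
            gcongr
            exact Nat.sub_le _ _
      _ = q * (q : ℝ) ^ d * (q : ℝ)⁻¹ ^ j := by
          push_cast
          have : d = (d - 2 * j) + j + j := by omega
          conv_rhs => rw [this, pow_add, pow_add]
          rw [inv_pow]
          field_simp
  refine (Finset.sum_le_sum h4).trans ?_
  rw [← Finset.mul_sum]
  have h5 : ∑ j ∈ (Finset.Ico M (d + 1)).filter (fun j => 2 * j ≤ d), (q : ℝ)⁻¹ ^ j ≤
      2 * (q : ℝ)⁻¹ ^ M := by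
    refine (Finset.sum_le_sum_of_subset_of_nonneg (Finset.filter_subset _ _)
      fun _ _ _ => by positivity).trans ?_
    refine (geom_sum_Ico_le_of_lt_one (by positivity) (by linarith)).trans ?_
    rw [div_le_iff₀ (by linarith)]
    have : 0 ≤ (q : ℝ)⁻¹ ^ M := by positivity
    nlinarith
  calc q * (q : ℝ) ^ d * _ ≤ q * (q : ℝ) ^ d * (2 * (q : ℝ)⁻¹ ^ M) := by gcongr
    _ = _ := by ring

end Counting

section PowerFree

variable {F : Type*} [Field F]

/-- A nonzero polynomial fails to be `n`-th power free because of a monic irreducible. -/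
lemma exists_irreducible_pow_dvd {n : ℕ} (hn : n ≠ 0) {f : F[X]} (hf : f ≠ 0)
    (h : ¬ PowerFree n f) : ∃ p : F[X], Irreducible p ∧ p.Monic ∧ p ^ n ∣ f := by
  simp only [PowerFree, not_forall] at h
  obtain ⟨g, hg, hu⟩ := h
  have hg0 : g ≠ 0 := by
    rintro rfl
    rw [zero_pow hn, zero_dvd_iff] at hg
    exact hf hg
  obtain ⟨p, hp, hpg⟩ := WfDvdMonoid.exists_irreducible_factor hu hg0
  classical
  refine ⟨normalize p, (associated_normalize p).irreducible hp, monic_normalize hp.ne_zero, ?_⟩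
  exact (pow_dvd_pow_of_dvd ((normalize_dvd_iff).mpr hpg) n).trans hg

/-- A polynomial without simple irreducible factors has a square factor of at least two thirds of
its degree. -/
lemma exists_sq_dvd_of_squarefull {f : F[X]} (hf : f ≠ 0)
    (h : ∀ p : F[X], Irreducible p → p ∣ f → p ^ 2 ∣ f) :
    ∃ g : F[X], g ^ 2 ∣ f ∧ f.natDegree ≤ 3 * g.natDegree := by
  induction f using UniqueFactorizationMonoid.induction_on_coprime with
  | h0 => exact absurd rfl hf
  | @h1 u hu => exact ⟨1, by simp, by simp [natDegree_eq_zero_of_isUnit hu]⟩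
  | @hpr p i hp =>
    refine ⟨p ^ (i / 2), ?_, ?_⟩
    · rw [← pow_mul]
      exact pow_dvd_pow p (Nat.div_mul_le_self i 2)
    · rw [natDegree_pow, natDegree_pow]
      have hi : i ≠ 1 := by
        rintro rfl
        have h2 := h p hp.irreducible (by simp)
        rw [pow_one] at h2
        have h3 := natDegree_le_of_dvd h2 hp.ne_zero
        rw [natDegree_pow] at h3
        have := hp.irreducible.natDegree_pos
        omega
      have : i ≤ 3 * (i / 2) := by omega
      calc i * p.natDegree ≤ 3 * (i / 2) * p.natDegree := Nat.mul_le_mul_right _ this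
        _ = _ := by ring
  | @hcp u v huv hu hv =>
    have hu0 : u ≠ 0 := left_ne_zero_of_mul hf
    have hv0 : v ≠ 0 := right_ne_zero_of_mul hf
    have hcop := huv.isCoprime
    obtain ⟨g₁, hg₁, hd₁⟩ := hu hu0 fun p hp hpu =>
      ((hcop.of_isCoprime_of_dvd_left hpu).pow_left).dvd_of_dvd_mul_right
        (h p hp (hpu.mul_right v))
    obtain ⟨g₂, hg₂, hd₂⟩ := hv hv0 fun p hp hpv =>
      ((hcop.symm.of_isCoprime_of_dvd_left hpv).pow_left).dvd_of_dvd_mul_left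
        (h p hp (hpv.mul_left u))
    have hg10 : g₁ ≠ 0 := by rintro rfl; simp at hg₁; exact hu0 hg₁
    have hg20 : g₂ ≠ 0 := by rintro rfl; simp at hg₂; exact hv0 hg₂
    refine ⟨g₁ * g₂, by rw [mul_pow]; exact mul_dvd_mul hg₁ hg₂, ?_⟩
    rw [natDegree_mul hu0 hv0, natDegree_mul hg10 hg20]
    omega

variable [Fintype F]

/-- A positive proportion of the polynomials of degree `d` is `n`-th power free. A square factor
that is irreducible of degree at least `2` has a nonzero constant coefficient; discarding the other
factors keeps the sum over all square factors below the total. -/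
lemma le_ncard_powerFree {n : ℕ} (hn : 2 ≤ n) (d : ℕ) :
    (Fintype.card F : ℝ) ^ d / 4 ≤ ({f : F[X] | f.degree = d ∧ PowerFree n f}.ncard : ℝ) := by
  set q := Fintype.card F with hq
  have hq2 : (2 : ℝ) ≤ q := two_le_card
  have hq2' : 2 ≤ q := by exact_mod_cast hq2
  have hq0 : (0 : ℝ) < q := by linarith
  have hinv : (q : ℝ)⁻¹ ≤ 2⁻¹ := inv_anti₀ two_pos hq2
  have hinv0 : 0 < (q : ℝ)⁻¹ := inv_pos.mpr hq0
  let T : ℕ → Set F[X] := fun j => {g : F[X] | g.Monic ∧ g.natDegree = j ∧ (j = 1 ∨ g.coeff 0 ≠ 0)}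
  have h1 := ncard_sq_dvd_le d (Finset.Ico 1 (d + 1)) T (fun j g hg => ⟨hg.1, hg.2.1⟩)
  set bad := {f : F[X] | f.degree = d ∧ ∃ j ∈ Finset.Ico 1 (d + 1), ∃ g ∈ T j, g ^ 2 ∣ f}
  have hsub : {f : F[X] | f.degree = d} ⊆ {f : F[X] | f.degree = d ∧ PowerFree n f} ∪ bad := by
    intro f hf
    by_cases hpf : PowerFree n f
    · exact Or.inl ⟨hf, hpf⟩
    right
    have hf0 : f ≠ 0 := by rintro rfl; simp at hf
    obtain ⟨p, hp, hmon, hdvd⟩ := exists_irreducible_pow_dvd (by omega) hf0 hpf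
    have hdvd2 : p ^ 2 ∣ f := (pow_dvd_pow p hn).trans hdvd
    refine ⟨hf, p.natDegree, ?_, p, ⟨hmon, rfl, ?_⟩, hdvd2⟩
    · have := natDegree_le_of_dvd hdvd2 hf0
      rw [natDegree_pow, natDegree_eq_of_degree_eq_some hf] at this
      have := hp.natDegree_pos
      rw [Finset.mem_Ico]
      omega
    · by_contra! hcon
      obtain ⟨h, hh⟩ := X_dvd_iff.mpr hcon.2
      rcases hp.isUnit_or_isUnit hh with hu | hu
      · exact not_isUnit_X hu
      · refine hcon.1 ?_
        have hh0 : h ≠ 0 := hu.ne_zero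
        rw [hh, natDegree_X_mul hh0, natDegree_eq_zero_of_isUnit hu]
  have hfin := finite_degree_eq (F := F) d
  have h2 := (Set.ncard_le_ncard hsub ((hfin.subset fun f hf => hf.1).union
    (hfin.subset fun f hf => hf.1))).trans (Set.ncard_union_le _ _)
  rw [ncard_degree_eq] at h2
  have h3 : (((q - 1) * q ^ d : ℕ) : ℝ) ≤
      ({f : F[X] | f.degree = d ∧ PowerFree n f}.ncard : ℝ) + (bad.ncard : ℝ) := by
    exact_mod_cast h2
  rw [Nat.cast_mul, Nat.cast_pow, Nat.cast_sub (by omega), Nat.cast_one] at h3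
  have h4 : (bad.ncard : ℝ) ≤ (q - 1) * (q : ℝ) ^ d * ((q : ℝ)⁻¹ + (q : ℝ)⁻¹ ^ 2) := by
    have h5 : (bad.ncard : ℝ) ≤ _ := Nat.cast_le.mpr h1
    refine h5.trans ?_
    rw [Nat.cast_sum]
    have h6 : ∀ j ∈ (Finset.Ico 1 (d + 1)).filter (fun j => 2 * j ≤ d),
        (((T j).ncard * ((q - 1) * q ^ (d - 2 * j)) : ℕ) : ℝ) ≤ (q - 1) * (q : ℝ) ^ d *
          ((if j = 1 then (q : ℝ)⁻¹ else 0) +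
            if j ∈ Finset.Ico 2 (d + 1) then (1 - (q : ℝ)⁻¹) * (q : ℝ)⁻¹ ^ j else 0) := by
      intro j hj
      rw [Finset.mem_filter, Finset.mem_Ico] at hj
      obtain ⟨⟨hj1, hjd⟩, hj2⟩ := hj
      have hd : (q : ℝ) ^ d = (q : ℝ) ^ (d - 2 * j) * (q : ℝ) ^ j * (q : ℝ) ^ j := by
        rw [← pow_add, ← pow_add]
        congr 1
        omega
      by_cases hj' : j = 1
      · subst hj'
        have hT : (T 1).ncard = q := by
          have : T 1 = {g : F[X] | g.Monic ∧ g.natDegree = 1} := by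
            ext g
            simp [T]
          rw [this, ncard_monic_natDegree_eq, pow_one]
        rw [hT]
        simp only [if_true, Finset.mem_Ico]
        rw [if_neg (by omega), hd]
        push_cast [Nat.cast_sub (show 1 ≤ q by omega)]
        apply le_of_eq
        field_simp
        ring
      · obtain ⟨i, rfl⟩ : ∃ i, j = i + 1 := ⟨j - 1, by omega⟩
        have hT : (T (i + 1)).ncard = (q - 1) * q ^ i := by
          have : T (i + 1) = {g : F[X] | g.Monic ∧ g.natDegree = i + 1 ∧ g.coeff 0 ≠ 0} := by
            ext g
            simp [T, show i ≠ 0 by omega]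
          rw [this, ncard_monic_natDegree_eq_coeff_zero_ne]
        rw [hT, if_neg hj', if_pos (Finset.mem_Ico.mpr ⟨by omega, hjd⟩), hd]
        push_cast [Nat.cast_sub (show 1 ≤ q by omega)]
        apply le_of_eq
        rw [inv_pow]
        field_simp
        ring
    refine (Finset.sum_le_sum h6).trans ?_
    rw [← Finset.mul_sum]
    have hq1 : (0 : ℝ) ≤ (q - 1) * (q : ℝ) ^ d := mul_nonneg (by linarith) (by positivity)
    refine mul_le_mul_of_nonneg_left ?_ hq1
    have hinv1 : 0 < 1 - (q : ℝ)⁻¹ := by linarith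
    refine (Finset.sum_le_sum_of_subset_of_nonneg (Finset.filter_subset _ _)
      fun j _ _ => add_nonneg (by split_ifs <;> positivity) (by
        split_ifs
        · exact mul_nonneg hinv1.le (by positivity)
        · exact le_rfl)).trans ?_
    rw [Finset.sum_add_distrib]
    refine add_le_add ?_ ?_
    · rw [Finset.sum_ite_eq' (Finset.Ico 1 (d + 1))]
      split_ifs
      exacts [le_rfl, hinv0.le]
    · rw [← Finset.sum_filter]
      have h7 : (Finset.Ico 1 (d + 1)).filter (fun j => j ∈ Finset.Ico 2 (d + 1)) =
          Finset.Ico 2 (d + 1) := by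
        ext j
        simp only [Finset.mem_filter, Finset.mem_Ico]
        omega
      rw [h7, ← Finset.mul_sum]
      have := geom_sum_Ico_le_of_lt_one (m := 2) (n := d + 1) hinv0.le (by linarith)
      rw [le_div_iff₀ hinv1] at this
      linarith
  have h8 : (q : ℝ)⁻¹ + (q : ℝ)⁻¹ ^ 2 ≤ 3 / 4 := by nlinarith
  have h9 : (0 : ℝ) < (q : ℝ) ^ d := by positivity
  have h10 : (q - 1) * (q : ℝ) ^ d * ((q : ℝ)⁻¹ + (q : ℝ)⁻¹ ^ 2) ≤
      (q - 1) * (q : ℝ) ^ d * (3 / 4) :=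
    mul_le_mul_of_nonneg_left h8 (mul_nonneg (by linarith) h9.le)
  nlinarith

/-- Almost all polynomials have a simple irreducible factor. -/
lemma ncard_squarefull_le (d : ℕ) :
    ({f : F[X] | f.degree = d ∧ ∀ p : F[X], Irreducible p → p ∣ f → p ^ 2 ∣ f}.ncard : ℝ) ≤
      2 * Fintype.card F * (Fintype.card F : ℝ)⁻¹ ^ (d / 3) * (Fintype.card F : ℝ) ^ d := by
  refine le_trans (Nat.cast_le.mpr (Set.ncard_le_ncard ?_
    ((finite_degree_eq d).subset fun f hf => hf.1))) (ncard_sq_dvd_large_le (d / 3) d)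
  rintro f ⟨hf, h⟩
  have hf0 : f ≠ 0 := by rintro rfl; simp at hf
  obtain ⟨g, hg, hdeg⟩ := exists_sq_dvd_of_squarefull hf0 h
  have hg0 : g ≠ 0 := by rintro rfl; simp at hg; exact hf0 hg
  classical
  rw [natDegree_eq_of_degree_eq_some hf] at hdeg
  refine ⟨hf, normalize g, monic_normalize hg0, ?_, ?_⟩
  · rw [natDegree_eq_of_degree_eq (degree_normalize)]
    omega
  · exact (pow_dvd_pow_of_dvd (normalize_dvd_iff.mpr dvd_rfl) 2).trans hg

end PowerFree

/-! ### Equidistribution of local data -/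

section LocalData

variable {F : Type*} [Field F]

/-- The local data of `f` at the rational points of the line: the first `n` coefficients of the
expansion of `f` in powers of `x - a`, for every `a`. -/
noncomputable def localData (n : ℕ) (f : F[X]) (a : F) : Fin n → F := fun i => (taylor a f).coeff i

lemma localData_add (n : ℕ) (f g : F[X]) :
    localData n (f + g) = localData n f + localData n g := by
  ext a i
  simp [localData]

lemma localData_eq_zero_iff {n : ℕ} {f : F[X]} {a : F} :
    localData n f a = 0 ↔ (X - C a) ^ n ∣ f := by
  rw [X_sub_C_pow_dvd_iff, X_pow_dvd_iff]
  constructor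
  · intro h d hd
    exact congrFun h ⟨d, hd⟩
  · intro h
    ext i
    exact h i i.2

lemma PowerFree.localData_ne_zero {n : ℕ} {f : F[X]} (hf : PowerFree n f) (a : F) :
    localData n f a ≠ 0 := fun h =>
  not_isUnit_X_sub_C a (hf _ (localData_eq_zero_iff.mp h))

/-- Hermite interpolation at all rational points, by a multiple of a polynomial without rational
roots. -/
lemma exists_localData_eq [Finite F] {n : ℕ} {Q : F[X]} (hQ : ∀ a, Q.eval a ≠ 0)
    (v : F → Fin n → F) : ∃ δ : F[X], localData n δ = v ∧ Q ∣ δ := by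
  let I : Option F → Ideal F[X] := fun o => o.elim (Ideal.span {Q})
    fun a => Ideal.span {(X - C a) ^ n}
  have hQa : ∀ a, IsCoprime Q ((X - C a) ^ n) := fun a => by
    refine IsCoprime.pow_right ?_
    rw [isCoprime_comm]
    exact (Irreducible.coprime_iff_not_dvd (irreducible_X_sub_C a)).mpr
      fun h => hQ a (dvd_iff_isRoot.mp h)
  have hI : Pairwise (Function.onFun IsCoprime I) := by
    rintro (_ | a) (_ | b) hab
    · exact absurd rfl hab
    · exact (Ideal.isCoprime_span_singleton_iff _ _).mpr (hQa b)
    · exact (Ideal.isCoprime_span_singleton_iff _ _).mpr (hQa a).symm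
    · refine (Ideal.isCoprime_span_singleton_iff _ _).mpr (IsCoprime.pow ?_)
      exact pairwise_coprime_X_sub_C Function.injective_id (fun h => hab (congrArg some h))
  let h : F → F[X] := fun a => taylor (-a) (∑ i : Fin n, C (v a i) * X ^ (i : ℕ))
  have hh : ∀ a, localData n (h a) a = v a := by
    intro a
    ext i
    simp only [localData, h, taylor_taylor, add_neg_cancel, taylor_zero]
    simp [finsetSum_coeff, coeff_C_mul, coeff_X_pow, Fin.val_inj]
  obtain ⟨δ, hδ⟩ := Ideal.exists_forall_sub_mem_ideal hI (fun o => o.elim 0 h)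
  refine ⟨δ, ?_, ?_⟩
  · ext1 a
    have h1 : localData n (δ - h a) a = 0 :=
      localData_eq_zero_iff.mpr (Ideal.mem_span_singleton.mp (hδ (some a)))
    have h2 := congrFun (localData_add n (δ - h a) (h a)) a
    rw [sub_add_cancel, Pi.add_apply, h1, zero_add, hh] at h2
    exact h2
  · have := Ideal.mem_span_singleton.mp (hδ none)
    simpa using this

variable [Fintype F]

/-- Two choices of nonzero local data are about equally likely among the `n`-th power free
polynomials of large degree: translation by a fixed polynomial that is divisible by `g ^ n` for
all `g` of degree at most `M` without rational roots carries one set to the other, up to polynomials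
divisible by the square of a polynomial of degree at least `M`. -/
lemma ncard_localData_le {n : ℕ} (hn : 2 ≤ n) (M : ℕ) (u u' : F → Fin n → F)
    (hu' : ∀ a, u' a ≠ 0) :
    ∀ᶠ d : ℕ in atTop, {f : F[X] | f.degree = d ∧ PowerFree n f ∧ localData n f = u}.ncard ≤
      {f : F[X] | f.degree = d ∧ PowerFree n f ∧ localData n f = u'}.ncard +
      {f : F[X] | f.degree = d ∧ ∃ g : F[X], g.Monic ∧ M ≤ g.natDegree ∧ g ^ 2 ∣ f}.ncard := by
  have hfin : {g : F[X] | g.natDegree ≤ M ∧ ∀ a, g.eval a ≠ 0}.Finite := by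
    refine ((Set.finite_le_nat M).biUnion fun d _ => finite_degree_eq (F := F) d).subset ?_
    rintro g ⟨hg, hga⟩
    have hg0 : g ≠ 0 := by rintro rfl; simpa using hga 0
    exact Set.mem_biUnion hg (degree_eq_natDegree hg0)
  set Q : F[X] := (∏ g ∈ hfin.toFinset, g) ^ n with hQ
  have hQa : ∀ a, Q.eval a ≠ 0 := fun a => by
    rw [hQ, eval_pow, eval_prod]
    refine pow_ne_zero _ (Finset.prod_ne_zero_iff.mpr fun g hg => ?_)
    exact (hfin.mem_toFinset.mp hg).2 a
  obtain ⟨δ, hδ, hQδ⟩ := exists_localData_eq hQa (u' - u)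
  filter_upwards [eventually_gt_atTop δ.natDegree] with d hd
  rw [← Set.ncard_image_of_injective _ (add_left_injective δ)]
  refine (Set.ncard_le_ncard ?_ (((finite_degree_eq d).subset fun f hf => hf.1).union
    ((finite_degree_eq d).subset fun f hf => hf.1))).trans (Set.ncard_union_le _ _)
  rintro _ ⟨f, ⟨hf, hpf, rfl⟩, rfl⟩
  have hdeg : (f + δ).degree = d := by
    rw [degree_add_eq_left_of_degree_lt, hf]
    rw [hf]
    exact degree_le_natDegree.trans_lt (by exact_mod_cast hd)
  have hdata : localData n (f + δ) = u' := by rw [localData_add, hδ, add_sub_cancel]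
  by_cases hpf' : PowerFree n (f + δ)
  · exact Or.inl ⟨hdeg, hpf', hdata⟩
  right
  have h0 : f + δ ≠ 0 := by
    intro h
    rw [h] at hdeg
    simp at hdeg
  obtain ⟨p, hp, hmon, hdvd⟩ := exists_irreducible_pow_dvd (by omega) h0 hpf'
  refine ⟨hdeg, p, hmon, ?_, (pow_dvd_pow p hn).trans hdvd⟩
  by_contra! hlt
  have hroot : ∀ a, p.eval a ≠ 0 := by
    intro a ha
    have hass : (X - C a) ∣ p := dvd_iff_isRoot.mpr ha
    refine hu' a ?_
    rw [← hdata, localData_eq_zero_iff]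
    exact (pow_dvd_pow_of_dvd hass n).trans hdvd
  have hpQ : p ^ n ∣ Q :=
    pow_dvd_pow_of_dvd (Finset.dvd_prod_of_mem _ (hfin.mem_toFinset.mpr ⟨hlt.le, hroot⟩)) n
  exact hp.not_isUnit (hpf p ((dvd_add_left (hpQ.trans hQδ)).mp hdvd))

/-- The property `R` fails only for a negligible proportion of the polynomials of degree `d`, as `d`
grows. -/
def HoldsAlmostSurely (R : F[X] → Prop) : Prop :=
  ∀ ε > (0 : ℝ), ∀ᶠ d : ℕ in atTop,
    ({f : F[X] | f.degree = d ∧ ¬ R f}.ncard : ℝ) ≤ ε * (Fintype.card F : ℝ) ^ d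

lemma tendsto_two_mul_card_mul_inv_pow :
    Tendsto (fun M : ℕ => 2 * (Fintype.card F : ℝ) * (Fintype.card F : ℝ)⁻¹ ^ M) atTop (𝓝 0) := by
  have hq2 : (2 : ℝ) ≤ Fintype.card F := two_le_card
  have hinv : (Fintype.card F : ℝ)⁻¹ ≤ 2⁻¹ := inv_anti₀ two_pos hq2
  have := tendsto_pow_atTop_nhds_zero_of_lt_one (r := (Fintype.card F : ℝ)⁻¹) (by positivity)
    (by linarith)
  simpa using this.const_mul (2 * (Fintype.card F : ℝ))

lemma holdsAlmostSurely_of_simple_factor {R : F[X] → Prop}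
    (h : ∀ f p : F[X], Irreducible p → p ∣ f → ¬ p ^ 2 ∣ f → R f) : HoldsAlmostSurely R := by
  intro ε hε
  have h1 := (tendsto_two_mul_card_mul_inv_pow (F := F)).comp
    (Nat.tendsto_div_const_atTop (n := 3) (by norm_num))
  filter_upwards [h1.eventually_lt_const hε] with d hd
  refine le_trans (Nat.cast_le.mpr (Set.ncard_le_ncard ?_
    ((finite_degree_eq d).subset fun f hf => hf.1))) ((ncard_squarefull_le d).trans ?_)
  · rintro f ⟨hf, hR⟩
    exact ⟨hf, fun p hp hpf => by_contra fun hp2 => hR (h f p hp hpf hp2)⟩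
  · exact mul_le_mul_of_nonneg_right hd.le (by positivity)

/-- Almost sure restrictions do not affect the equidistribution of local data. -/
lemma ncard_restricted_localData_le {n : ℕ} (hn : 2 ≤ n) {R : F[X] → Prop}
    (hR : HoldsAlmostSurely R) (u u' : F → Fin n → F) (hu' : ∀ a, u' a ≠ 0) {ε : ℝ} (hε : 0 < ε) :
    ∀ᶠ d : ℕ in atTop,
      ({f : F[X] | f.degree = d ∧ PowerFree n f ∧ R f ∧ localData n f = u}.ncard : ℝ) ≤
      ({f : F[X] | f.degree = d ∧ PowerFree n f ∧ R f ∧ localData n f = u'}.ncard : ℝ) +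
        ε * (Fintype.card F : ℝ) ^ d := by
  obtain ⟨M, hM⟩ := ((tendsto_two_mul_card_mul_inv_pow (F := F)).eventually_lt_const
    (half_pos hε)).exists
  filter_upwards [ncard_localData_le hn M u u' hu', hR (ε / 2) (half_pos hε)] with d h1 h2
  have hfin := finite_degree_eq (F := F) d
  have h3 : {f : F[X] | f.degree = d ∧ PowerFree n f ∧ R f ∧ localData n f = u}.ncard ≤
      {f : F[X] | f.degree = d ∧ PowerFree n f ∧ localData n f = u}.ncard :=
    Set.ncard_le_ncard (fun f hf => ⟨hf.1, hf.2.1, hf.2.2.2⟩) (hfin.subset fun f hf => hf.1)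
  have h4 : {f : F[X] | f.degree = d ∧ PowerFree n f ∧ localData n f = u'}.ncard ≤
      {f : F[X] | f.degree = d ∧ PowerFree n f ∧ R f ∧ localData n f = u'}.ncard +
        {f : F[X] | f.degree = d ∧ ¬ R f}.ncard := by
    refine (Set.ncard_le_ncard ?_ ((hfin.subset fun f hf => hf.1).union
      (hfin.subset fun f hf => hf.1))).trans (Set.ncard_union_le _ _)
    rintro f ⟨hf, hpf, hfu⟩
    by_cases hRf : R f
    · exact Or.inl ⟨hf, hpf, hRf, hfu⟩
    · exact Or.inr ⟨hf, hRf⟩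
  have h5 := ncard_sq_dvd_large_le (F := F) M d
  have h6 : 2 * (Fintype.card F : ℝ) * (Fintype.card F : ℝ)⁻¹ ^ M * (Fintype.card F : ℝ) ^ d ≤
      ε / 2 * (Fintype.card F : ℝ) ^ d := mul_le_mul_of_nonneg_right hM.le (by positivity)
  have h7 := (h3.trans h1).trans (Nat.add_le_add_right h4 _)
  have h8 : ({f : F[X] | f.degree = d ∧ PowerFree n f ∧ R f ∧ localData n f = u}.ncard : ℝ) ≤
      {f : F[X] | f.degree = d ∧ PowerFree n f ∧ R f ∧ localData n f = u'}.ncard +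
        {f : F[X] | f.degree = d ∧ ¬ R f}.ncard +
        {f : F[X] | f.degree = d ∧ ∃ g : F[X], g.Monic ∧ M ≤ g.natDegree ∧ g ^ 2 ∣ f}.ncard := by
    exact_mod_cast h7
  linarith

lemma le_ncard_restricted {n : ℕ} (hn : 2 ≤ n) {R : F[X] → Prop} (hR : HoldsAlmostSurely R) :
    ∀ᶠ d : ℕ in atTop, (1 / 8 : ℝ) * (Fintype.card F : ℝ) ^ d ≤
      ({f : F[X] | f.degree = d ∧ PowerFree n f ∧ R f}.ncard : ℝ) := by
  filter_upwards [hR (1 / 8) (by norm_num)] with d hd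
  have h1 := le_ncard_powerFree (F := F) hn d
  have hfin := finite_degree_eq (F := F) d
  have h2 : {f : F[X] | f.degree = d ∧ PowerFree n f}.ncard ≤
      {f : F[X] | f.degree = d ∧ PowerFree n f ∧ R f}.ncard +
        {f : F[X] | f.degree = d ∧ ¬ R f}.ncard := by
    refine (Set.ncard_le_ncard ?_ ((hfin.subset fun f hf => hf.1).union
      (hfin.subset fun f hf => hf.1))).trans (Set.ncard_union_le _ _)
    rintro f ⟨hf, hpf⟩
    by_cases hRf : R f
    · exact Or.inl ⟨hf, hpf, hRf⟩
    · exact Or.inr ⟨hf, hRf⟩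
  have h3 : ({f : F[X] | f.degree = d ∧ PowerFree n f}.ncard : ℝ) ≤
      {f : F[X] | f.degree = d ∧ PowerFree n f ∧ R f}.ncard +
        {f : F[X] | f.degree = d ∧ ¬ R f}.ncard := by exact_mod_cast h2
  linarith

/-- Counts that are asymptotically equal to each other divide the total equally. -/
lemma tendsto_sum_div_sum {ι : Type*} (G W : Finset ι) (hWG : W ⊆ G) (N : ι → ℕ → ℝ)
    (w : ℕ → ℝ) {c : ℝ} (hc : 0 < c) (hw : ∀ d, 0 < w d)
    (hN : ∀ i ∈ G, ∀ j ∈ G, ∀ ε > 0, ∀ᶠ d in atTop, N i d ≤ N j d + ε * w d)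
    (hG : ∀ᶠ d in atTop, c * w d ≤ ∑ i ∈ G, N i d) :
    Tendsto (fun d => (∑ i ∈ W, N i d) / ∑ i ∈ G, N i d) atTop (𝓝 (W.card / G.card)) := by
  rcases G.eq_empty_or_nonempty with rfl | hne
  · simp [Finset.subset_empty.mp hWG]
  have hG0 : (0 : ℝ) < G.card := by exact_mod_cast hne.card_pos
  rw [Metric.tendsto_atTop']
  suffices h : ∀ ε > 0, ∀ᶠ d in atTop,
      dist ((∑ i ∈ W, N i d) / ∑ i ∈ G, N i d) (W.card / G.card : ℝ) < ε by
    intro ε hε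
    obtain ⟨a, ha⟩ := eventually_atTop.mp (h ε hε)
    exact ⟨a, fun d hd => ha d hd.le⟩
  intro ε hε
  set η : ℝ := ε * c / (2 * (W.card + 1)) with hη
  have hη0 : 0 < η := by positivity
  have hev : ∀ᶠ d in atTop, ∀ i ∈ G, ∀ j ∈ G, N i d ≤ N j d + η * w d := by
    rw [eventually_all_finset]
    intro i hi
    rw [eventually_all_finset]
    exact fun j hj => hN i hi j hj η hη0
  filter_upwards [hev, hG] with d h1 h2
  set S := ∑ i ∈ G, N i d
  have hwd := hw d
  have hS : 0 < S := lt_of_lt_of_le (by positivity) h2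
  -- Compare `|G| * ∑_W N` with `|W| * ∑_G N` term by term.
  have h3 : |G.card * ∑ i ∈ W, N i d - W.card * S| ≤ W.card * G.card * (η * w d) := by
    have h4 : G.card * ∑ i ∈ W, N i d - W.card * S = ∑ i ∈ W, ∑ j ∈ G, (N i d - N j d) := by
      simp only [Finset.sum_sub_distrib, Finset.sum_const, nsmul_eq_mul, S]
      rw [Finset.mul_sum]
    rw [h4]
    refine (Finset.abs_sum_le_sum_abs _ _).trans ?_
    have h5 : ∀ i ∈ W, |∑ j ∈ G, (N i d - N j d)| ≤ G.card * (η * w d) := by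
      intro i hi
      refine (Finset.abs_sum_le_sum_abs _ _).trans ?_
      have : ∀ j ∈ G, |N i d - N j d| ≤ η * w d := by
        intro j hj
        rw [abs_le]
        have := h1 i (hWG hi) j hj
        have := h1 j hj i (hWG hi)
        constructor <;> linarith
      refine (Finset.sum_le_sum this).trans ?_
      rw [Finset.sum_const, nsmul_eq_mul]
    refine (Finset.sum_le_sum h5).trans ?_
    rw [Finset.sum_const, nsmul_eq_mul, mul_assoc]
  rw [Real.dist_eq, div_sub_div _ _ hS.ne' hG0.ne', abs_div, abs_of_pos (mul_pos hS hG0),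
    div_lt_iff₀ (mul_pos hS hG0), mul_comm _ (G.card : ℝ), mul_comm S (W.card : ℝ)]
  refine h3.trans_lt ?_
  have h6 : (W.card : ℝ) * η ≤ ε * c / 2 := by
    rw [hη, mul_div_assoc', div_le_div_iff₀ (by positivity) two_pos]
    have : (0 : ℝ) ≤ W.card := by positivity
    nlinarith [mul_pos hε hc]
  calc (W.card : ℝ) * G.card * (η * w d) = W.card * η * (w d * G.card) := by ring
    _ ≤ ε * c / 2 * (w d * G.card) := by gcongr
    _ < ε * (c * w d) * G.card := by nlinarith [mul_pos (mul_pos hε hc) (mul_pos hwd hG0)]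
    _ ≤ ε * S * G.card := by gcongr
    _ = ε * (S * G.card) := by ring

/-- If `N f a` depends only on the local data of `f` at `a`, then the values of `N f` are in the
limit distributed like the values at independent, uniformly distributed, nonzero local data. -/
theorem tendsto_proportion {n : ℕ} (hn : 2 ≤ n) {R : F[X] → Prop} (hR : HoldsAlmostSurely R)
    {N : F[X] → F → ℕ} {Ψ : (Fin n → F) → ℕ}
    (hN : ∀ f, PowerFree n f → ∀ a, N f a = Ψ (localData n f a)) (k : F → ℤ) :
    Tendsto (proportion n R N k) atTop
      (𝓝 (∏ a, ({v : Fin n → F | v ≠ 0 ∧ (Ψ v : ℤ) = k a}.ncard : ℝ) /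
        ({v : Fin n → F | v ≠ 0}.ncard : ℝ))) := by
  classical
  let c : (F → Fin n → F) → ℕ → ℝ := fun u d =>
    ({f : F[X] | f.degree = d ∧ PowerFree n f ∧ R f ∧ localData n f = u}.ncard : ℝ)
  let S : (F → Set (Fin n → F)) → Finset (F → Fin n → F) := fun V =>
    Fintype.piFinset fun a => (Set.toFinite (V a)).toFinset
  have hS : ∀ V u, u ∈ S V ↔ ∀ a, u a ∈ V a := fun V u => by simp [S]
  have hcard : ∀ V, ((S V).card : ℝ) = ∏ a, ((V a).ncard : ℝ) := fun V => by
    rw [Fintype.card_piFinset, Nat.cast_prod]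
    simp_rw [← Set.ncard_eq_toFinset_card]
  have hsum : ∀ (V : F → Set (Fin n → F)) (d : ℕ),
      ({f : F[X] | f.degree = d ∧ PowerFree n f ∧ R f ∧ ∀ a, localData n f a ∈ V a}.ncard : ℝ) =
        ∑ u ∈ S V, c u d := by
    intro V d
    have hfin : ∀ P : F[X] → Prop, {f : F[X] | f.degree = d ∧ P f}.Finite := fun P =>
      (finite_degree_eq d).subset fun f hf => hf.1
    rw [Set.ncard_eq_toFinset_card _ (hfin _),
      Finset.card_eq_sum_card_fiberwise (f := localData n) (t := S V), Nat.cast_sum]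
    · refine Finset.sum_congr rfl fun u hu => ?_
      rw [hS] at hu
      congr 1
      rw [← Set.ncard_coe_finset]
      congr 1
      ext f
      simp only [Finset.coe_filter, Set.Finite.mem_toFinset, Set.mem_ofPred_eq]
      constructor
      · rintro ⟨⟨h1, h2, h3, -⟩, h4⟩
        exact ⟨h1, h2, h3, h4⟩
      · rintro ⟨h1, h2, h3, rfl⟩
        exact ⟨⟨h1, h2, h3, hu⟩, rfl⟩
    · intro f hf
      simp only [Set.Finite.coe_toFinset, Set.mem_ofPred_eq] at hf
      exact Finset.mem_coe.mpr ((hS V _).mpr hf.2.2.2)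
  let V₀ : F → Set (Fin n → F) := fun _ => {v | v ≠ 0}
  let V₁ : F → Set (Fin n → F) := fun a => {v | v ≠ 0 ∧ (Ψ v : ℤ) = k a}
  have hden : ∀ d : ℕ, ({f : F[X] | f.degree = d ∧ PowerFree n f ∧ R f}.ncard : ℝ) =
      ∑ u ∈ S V₀, c u d := by
    intro d
    rw [← hsum]
    congr 2
    ext f
    refine ⟨fun h => ⟨h.1, h.2.1, h.2.2, h.2.1.localData_ne_zero⟩,
      fun h => ⟨h.1, h.2.1, h.2.2.1⟩⟩
  have hnum : ∀ d : ℕ, ({f : F[X] | f.degree = d ∧ PowerFree n f ∧ R f ∧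
      ∀ a, (N f a : ℤ) = k a}.ncard : ℝ) = ∑ u ∈ S V₁, c u d := by
    intro d
    rw [← hsum]
    congr 2
    ext f
    refine ⟨fun h => ⟨h.1, h.2.1, h.2.2.1, fun a => ⟨h.2.1.localData_ne_zero a, ?_⟩⟩,
      fun h => ⟨h.1, h.2.1, h.2.2.1, fun a => ?_⟩⟩
    · rw [← hN f h.2.1]
      exact h.2.2.2 a
    · rw [hN f h.2.1]
      exact (h.2.2.2 a).2
  have key := tendsto_sum_div_sum (S V₀) (S V₁)
    (fun u hu => (hS _ _).mpr fun a => ((hS _ _).mp hu a).1) c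
    (fun d => (Fintype.card F : ℝ) ^ d) (c := 1 / 8) (by norm_num)
    (fun d => pow_pos (by linarith [two_le_card (F := F)]) d)
    (fun u hu u' hu' ε hε => ncard_restricted_localData_le hn hR u u' ((hS _ _).mp hu') hε)
    (by
      filter_upwards [le_ncard_restricted hn hR] with d hd
      rwa [← hden])
  rw [hcard, hcard, ← Finset.prod_div_distrib] at key
  refine key.congr fun d => ?_
  rw [proportion, hnum, hden]

end LocalData

/-! ### The limit laws -/

section RootCount

variable {F : Type*} [Field F] [Fintype F]

open Classical in
/-- An element of the cyclic group of units that has an `r`-th root has `gcd(r, q - 1)` of them. -/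
lemma card_pow_eq_units (r : ℕ) (hr : r ≠ 0) (u : Fˣ) :
    Nat.card {y : F // y ^ r = u} =
      if u ∈ (powMonoidHom r : Fˣ →* Fˣ).range then r.gcd (Fintype.card F - 1) else 0 := by
  have hq : Nat.card Fˣ = Fintype.card F - 1 := by
    rw [Nat.card_eq_fintype_card, Fintype.card_units]
  split_ifs with h
  · obtain ⟨w, rfl⟩ := h
    rw [Nat.gcd_comm, ← hq, ← IsCyclic.card_powMonoidHom_ker]
    symm
    refine Nat.card_congr (Equiv.ofBijective (fun z => ⟨((z.1 * w : Fˣ) : F), ?_⟩) ⟨?_, ?_⟩)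
    · have hz : z.1 ^ r = 1 := z.2
      rw [← Units.val_pow_eq_pow_val, mul_pow, hz, one_mul]
      rfl
    · intro z z' hzz
      have h1 : z.1 * w = z'.1 * w := Units.ext (congrArg Subtype.val hzz)
      exact Subtype.ext (mul_right_cancel h1)
    · rintro ⟨y, hy⟩
      have hy0 : y ≠ 0 := by
        rintro rfl
        rw [zero_pow hr] at hy
        exact Units.ne_zero _ hy.symm
      refine ⟨⟨Units.mk0 y hy0 * w⁻¹, ?_⟩, Subtype.ext (by simp)⟩
      rw [MonoidHom.mem_ker, powMonoidHom_apply, mul_pow, inv_pow, mul_inv_eq_one]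
      exact Units.ext hy
  · rw [Nat.card_eq_zero]
    left
    refine ⟨fun ⟨y, hy⟩ => h ?_⟩
    have hy0 : y ≠ 0 := by
      rintro rfl
      rw [zero_pow hr] at hy
      exact Units.ne_zero _ hy.symm
    exact ⟨Units.mk0 y hy0, Units.ext hy⟩

/-- The distribution of the number of `r`-th roots of a nonzero element of `F`. -/
lemma ncard_card_pow_eq (r : ℕ) (hr : r ≠ 0) (k : ℤ) :
    ({γ : F | γ ≠ 0 ∧ (Nat.card {y : F // y ^ r = γ} : ℤ) = k}.ncard : ℝ) =
      ((Fintype.card F : ℝ) - 1) *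
        ((if k = 0 then 1 - 1 / (r.gcd (Fintype.card F - 1) : ℝ) else 0) +
          if (r.gcd (Fintype.card F - 1) : ℤ) = k then
            1 / (r.gcd (Fintype.card F - 1) : ℝ) else 0) := by
  classical
  set q := Fintype.card F with hqdef
  have hq2 : 2 ≤ q := Fintype.one_lt_card
  set g := r.gcd (q - 1) with hg
  have hg0 : g ≠ 0 := (Nat.gcd_pos_of_pos_left _ (Nat.pos_of_ne_zero hr)).ne'
  have hgR : (g : ℝ) ≠ 0 := by exact_mod_cast hg0
  have hq : Nat.card Fˣ = q - 1 := by
    rw [Nat.card_eq_fintype_card, Fintype.card_units]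
  set H := (powMonoidHom r : Fˣ →* Fˣ).range with hH
  have hHcard : ((H : Set Fˣ).ncard : ℝ) * g = q - 1 := by
    have h1 : (H : Set Fˣ).ncard * g = q - 1 := by
      have h2 : (H : Set Fˣ).ncard = (q - 1) / g := by
        have := IsCyclic.card_powMonoidHom_range Fˣ r
        rw [hq, Nat.gcd_comm] at this
        exact this
      rw [h2]
      exact Nat.div_mul_cancel (Nat.gcd_dvd_right r (q - 1))
    have h3 : (((H : Set Fˣ).ncard * g : ℕ) : ℝ) = ((q - 1 : ℕ) : ℝ) := congrArg _ h1
    rw [Nat.cast_sub (by omega)] at h3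
    exact_mod_cast h3
  have hunits : {γ : F | γ ≠ 0 ∧ (Nat.card {y : F // y ^ r = γ} : ℤ) = k} =
      Units.val '' {u : Fˣ | ((if u ∈ H then g else 0 : ℕ) : ℤ) = k} := by
    ext γ
    constructor
    · rintro ⟨h0, h1⟩
      refine ⟨Units.mk0 γ h0, ?_, rfl⟩
      have := card_pow_eq_units r hr (Units.mk0 γ h0)
      rw [Units.val_mk0] at this
      rw [Set.mem_ofPred_eq, ← this, h1]
    · rintro ⟨u, hu, rfl⟩
      refine ⟨u.ne_zero, ?_⟩
      rw [card_pow_eq_units r hr u]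
      exact hu
  rw [hunits, Set.ncard_image_of_injective _ Units.val_injective]
  by_cases hk0 : k = 0
  · subst hk0
    have h1 : {u : Fˣ | ((if u ∈ H then g else 0 : ℕ) : ℤ) = 0} = (H : Set Fˣ)ᶜ := by
      ext u
      by_cases hu : u ∈ H <;> simp [hu, hg0]
    have h2 := Set.ncard_add_ncard_compl (H : Set Fˣ)
    rw [hq] at h2
    have h3 : (((H : Set Fˣ).ncard + (H : Set Fˣ)ᶜ.ncard : ℕ) : ℝ) = ((q - 1 : ℕ) : ℝ) :=
      congrArg _ h2
    rw [Nat.cast_sub (by omega), Nat.cast_add, Nat.cast_one] at h3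
    rw [h1, if_pos rfl, if_neg (by exact_mod_cast hg0), add_zero, mul_sub, mul_one_div,
      ← hHcard, mul_div_assoc, div_self hgR, hHcard]
    linarith
  · rw [if_neg hk0, zero_add]
    by_cases hkg : (g : ℤ) = k
    · subst hkg
      have h1 : {u : Fˣ | ((if u ∈ H then g else 0 : ℕ) : ℤ) = g} = (H : Set Fˣ) := by
        ext u
        by_cases hu : u ∈ H
        · simp [hu]
        · simpa [hu, eq_comm] using hg0
      rw [h1, if_pos rfl, ← hHcard]
      field_simp
    · have h1 : {u : Fˣ | ((if u ∈ H then g else 0 : ℕ) : ℤ) = k} = ∅ := by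
        ext u
        by_cases hu : u ∈ H <;> simp [hu, hkg, Ne.symm hk0]
      rw [h1, if_neg hkg]
      simp

end RootCount

section Law

variable {F : Type*} [Field F] {n : ℕ}

/-- The number of `e s`-th roots of the leading coefficient of `v`, where `s` is the order of
vanishing of `v` (and `0` if `v` vanishes): at most one summand is nonzero. -/
noncomputable def leadingRootCount (e : Fin n → ℕ) (v : Fin n → F) : ℕ :=
  open Classical in
  ∑ s, if (∀ i < s, v i = 0) ∧ v s ≠ 0 then Nat.card {y : F // y ^ e s = v s} else 0

lemma eq_of_leading {v : Fin n → F} {s t : Fin n} (hs : (∀ i < s, v i = 0) ∧ v s ≠ 0)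
    (ht : (∀ i < t, v i = 0) ∧ v t ≠ 0) : s = t :=
  le_antisymm (not_lt.mp fun h => ht.2 (hs.1 t h)) (not_lt.mp fun h => hs.2 (ht.1 s h))

lemma leadingRootCount_eq (e : Fin n → ℕ) {v : Fin n → F} {s : Fin n} (h0 : ∀ i < s, v i = 0)
    (hs : v s ≠ 0) : leadingRootCount e v = Nat.card {y : F // y ^ e s = v s} := by
  rw [leadingRootCount, Finset.sum_eq_single s, if_pos ⟨h0, hs⟩]
  · intro t _ hts
    rw [if_neg]
    exact fun ht => hts (eq_of_leading ht ⟨h0, hs⟩)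
  · simp

lemma exists_leading {v : Fin n → F} (hv : v ≠ 0) : ∃ s, (∀ i < s, v i = 0) ∧ v s ≠ 0 := by
  obtain ⟨i, hi⟩ := Function.ne_iff.mp hv
  obtain ⟨s, hs, hmin⟩ := WellFounded.has_min (wellFounded_lt (α := Fin n)) {i | v i ≠ 0} ⟨i, hi⟩
  exact ⟨s, fun i hi => by_contra fun h => hmin i h hi, hs⟩

variable [Fintype F]

lemma ncard_leading (s : Fin n) (Γ : Set F) :
    {v : Fin n → F | (∀ i < s, v i = 0) ∧ v s ∈ Γ}.ncard =
      Γ.ncard * Fintype.card F ^ (n - 1 - s) := by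
  classical
  have h1 : {v : Fin n → F | (∀ i < s, v i = 0) ∧ v s ∈ Γ} =
      (Fintype.piFinset fun i => if i < s then {0} else if i = s then (Set.toFinite Γ).toFinset
        else Finset.univ : Finset (Fin n → F)) := by
    ext v
    simp only [Set.mem_ofPred_eq, Finset.mem_coe, Fintype.mem_piFinset]
    constructor
    · rintro ⟨h0, hs⟩ i
      split_ifs with h2 h3
      · simpa using h0 i h2
      · subst h3
        simpa using hs
      · simp
    · intro h
      refine ⟨fun i hi => ?_, ?_⟩
      · have := h i
        rw [if_pos hi] at this
        simpa using this
      · have := h s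
        rw [if_neg (lt_irrefl s), if_pos rfl] at this
        simpa using this
  rw [h1, Set.ncard_coe_finset, Fintype.card_piFinset]
  have h2 : ∀ i, (if i < s then {0} else if i = s then (Set.toFinite Γ).toFinset
      else Finset.univ : Finset F).card =
      (if i = s then Γ.ncard else 1) * if s < i then Fintype.card F else 1 := by
    intro i
    rcases lt_trichotomy i s with h | h | h
    · rw [if_pos h, if_neg h.ne, if_neg h.not_gt, Finset.card_singleton]
    · subst h
      simp [Set.ncard_eq_toFinset_card _ (Set.toFinite Γ)]
    · rw [if_neg h.not_gt, if_neg h.ne', if_neg h.ne', if_pos h, one_mul, Finset.card_univ]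
  simp_rw [h2]
  rw [Finset.prod_mul_distrib, Finset.prod_ite_eq' Finset.univ s, if_pos (Finset.mem_univ s),
    ← Finset.prod_filter, Finset.prod_const]
  congr 2
  rw [← Fin.card_Ioi]
  congr 1
  ext i
  simp

lemma ncard_ne_zero (n : ℕ) :
    ({v : Fin n → F | v ≠ 0}.ncard : ℝ) = (Fintype.card F : ℝ) ^ n - 1 := by
  classical
  have h1 : {v : Fin n → F | v ≠ 0} = {0}ᶜ := rfl
  have h2 := Set.ncard_add_ncard_compl ({0} : Set (Fin n → F))
  rw [Set.ncard_singleton, Nat.card_eq_fintype_card, Fintype.card_fun, Fintype.card_fin] at h2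
  have h3 : ((1 + ({0} : Set (Fin n → F))ᶜ.ncard : ℕ) : ℝ) =
    ((Fintype.card F ^ n : ℕ) : ℝ) := congrArg _ h2
  push_cast at h3
  rw [h1]
  linarith

/-- The distribution of `leadingRootCount` for uniformly distributed nonzero vectors: the order of
vanishing `s` has a truncated geometric distribution, and the leading coefficient is uniform. -/
lemma leadingRootCount_law (hn : n ≠ 0) (e : ℕ → ℕ) (he : ∀ s, e s ≠ 0) (k : ℤ) :
    ({v : Fin n → F | v ≠ 0 ∧ (leadingRootCount (fun s => e s) v : ℤ) = k}.ncard : ℝ) /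
      ({v : Fin n → F | v ≠ 0}.ncard : ℝ) =
    ∑ s ∈ Finset.range n, ((Fintype.card F : ℝ) ^ s)⁻¹ * (1 - (Fintype.card F : ℝ)⁻¹) /
        (1 - ((Fintype.card F : ℝ) ^ n)⁻¹) *
      ((if k = 0 then 1 - 1 / ((e s).gcd (Fintype.card F - 1) : ℝ) else 0) +
          if ((e s).gcd (Fintype.card F - 1) : ℤ) = k then
            1 / ((e s).gcd (Fintype.card F - 1) : ℝ) else 0) := by
  classical
  set q := Fintype.card F with hq
  have hq2 : (2 : ℝ) ≤ q := two_le_card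
  have hqn : (1 : ℝ) < (q : ℝ) ^ n := one_lt_pow₀ (by linarith) hn
  let Γ : Fin n → Set F := fun s => {γ | γ ≠ 0 ∧ (Nat.card {y : F // y ^ e s = γ} : ℤ) = k}
  let V : Fin n → Finset (Fin n → F) := fun s =>
    (Set.toFinite {v : Fin n → F | (∀ i < s, v i = 0) ∧ v s ∈ Γ s}).toFinset
  have hV : {v : Fin n → F | v ≠ 0 ∧ (leadingRootCount (fun s => e s) v : ℤ) = k} =
      (Finset.univ.biUnion V : Finset (Fin n → F)) := by
    ext v
    simp only [Set.mem_ofPred_eq, Finset.coe_biUnion, Finset.coe_univ, Set.mem_univ,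
      Set.iUnion_true, Set.mem_iUnion, Set.Finite.coe_toFinset, V, Γ]
    constructor
    · rintro ⟨hv, hk⟩
      obtain ⟨s, h0, hs⟩ := exists_leading hv
      refine ⟨s, h0, hs, ?_⟩
      rwa [leadingRootCount_eq _ h0 hs] at hk
    · rintro ⟨s, h0, hs, hk⟩
      refine ⟨fun h => hs (congrFun h s), ?_⟩
      rwa [leadingRootCount_eq _ h0 hs]
  have hdisj : ((Finset.univ : Finset (Fin n)) : Set (Fin n)).PairwiseDisjoint V := by
    intro s _ t _ hst
    rw [Function.onFun, Finset.disjoint_left]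
    intro v hs ht
    simp only [Set.Finite.mem_toFinset, Set.mem_ofPred_eq, V, Γ] at hs ht
    exact hst (eq_of_leading ⟨hs.1, hs.2.1⟩ ⟨ht.1, ht.2.1⟩)
  rw [hV, Set.ncard_coe_finset, Finset.card_biUnion (fun s hs t ht hst => hdisj hs ht hst),
    Nat.cast_sum, ncard_ne_zero, Finset.sum_div, Finset.sum_range]
  refine Finset.sum_congr rfl fun s _ => ?_
  have h1 : ((V s).card : ℝ) = ((Γ s).ncard : ℝ) * (q : ℝ) ^ (n - 1 - s) := by
    rw [← Set.ncard_eq_toFinset_card, ncard_leading]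
    push_cast
    rfl
  rw [h1, ncard_card_pow_eq _ (he s)]
  have h2 : (q : ℝ) ^ n = (q : ℝ) ^ (n - 1 - s) * q * (q : ℝ) ^ (s : ℕ) := by
    rw [← pow_succ, ← pow_add]
    congr 1
    omega
  have h3 : (q : ℝ) ^ n - 1 ≠ 0 := by linarith
  have h4 : (0 : ℝ) < q := by linarith
  have h5 : ((q : ℝ) ^ (s : ℕ))⁻¹ * (1 - (q : ℝ)⁻¹) / (1 - ((q : ℝ) ^ n)⁻¹) =
      ((q : ℝ) - 1) * (q : ℝ) ^ (n - 1 - s) / ((q : ℝ) ^ n - 1) := by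
    have h6 : (1 - ((q : ℝ) ^ n)⁻¹) = ((q : ℝ) ^ n - 1) / (q : ℝ) ^ n := by
      rw [sub_div, div_self (by positivity), one_div]
    rw [h6, div_div_eq_mul_div]
    congr 1
    rw [h2]
    field_simp
  rw [h5]
  ring

lemma normLaw_eq {m : ℕ} (hm : m ≠ 0) (hn : n ≠ 0) (k : ℤ) :
    normLaw (Fintype.card F) m n k =
    ({v : Fin n → F | v ≠ 0 ∧ (leadingRootCount (fun s => m.gcd s) v : ℤ) = k}.ncard : ℝ) /
      ({v : Fin n → F | v ≠ 0}.ncard : ℝ) := by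
  have hgcd : ∀ s, (m.gcd s).gcd (Fintype.card F - 1) ≠ 0 := fun s =>
    (Nat.gcd_pos_of_pos_left _ (Nat.gcd_pos_of_pos_left _ (Nat.pos_of_ne_zero hm))).ne'
  rw [leadingRootCount_law hn (fun s => m.gcd s)
    (fun s => (Nat.gcd_pos_of_pos_left _ (Nat.pos_of_ne_zero hm)).ne'), normLaw]
  split_ifs with hk
  · subst hk
    refine Finset.sum_congr rfl fun s _ => ?_
    rw [if_neg (by exact_mod_cast hgcd s), add_zero, mul_comm]
  · rw [Finset.sum_filter]
    refine Finset.sum_congr rfl fun s _ => ?_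
    split_ifs with h
    · rw [← h, zero_add, Int.cast_natCast, mul_one_div, div_div, mul_comm ((_ : ℕ) : ℝ)]
    · simp

/-- The law of the points of the curve itself. The exponent `1` at positive order of vanishing
encodes that `y ^ m = 0` has exactly one solution. -/
lemma curveLaw_eq {m : ℕ} (hm : m ≠ 0) (hn : n ≠ 0) (k : ℤ) :
    curveLaw (Fintype.card F) m n k =
    ({v : Fin n → F | v ≠ 0 ∧
      (leadingRootCount (fun s => if (s : ℕ) = 0 then m else 1) v : ℤ) = k}.ncard : ℝ) /
      ({v : Fin n → F | v ≠ 0}.ncard : ℝ) := by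
  have hq2 : (2 : ℝ) ≤ Fintype.card F := two_le_card
  have hqn : (1 : ℝ) < (Fintype.card F : ℝ) ^ n := one_lt_pow₀ (by linarith) hn
  rw [leadingRootCount_law hn (fun s => if s = 0 then m else 1)
    (fun s => by split_ifs <;> omega), curveLaw]
  obtain ⟨l, rfl⟩ := Nat.exists_eq_succ_of_ne_zero hn
  set q : ℝ := (Fintype.card F : ℝ)
  have hq0 : q ≠ 0 := by linarith
  rw [Finset.sum_range_succ']
  have h1 : ∀ s, (if s + 1 = 0 then m else 1) = 1 := fun s => if_neg (Nat.succ_ne_zero s)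
  simp only [h1, if_true, Nat.gcd_one_left, Nat.cast_one, pow_zero, inv_one, one_mul, div_one,
    sub_self, ite_self, zero_add]
  rw [← Finset.sum_mul, ← Finset.sum_div, ← Finset.sum_mul]
  have h2 : (∑ s ∈ Finset.range l, (q ^ (s + 1))⁻¹) * (1 - q⁻¹) = q⁻¹ - (q ^ (l + 1))⁻¹ := by
    rw [Finset.sum_mul]
    have : ∀ s ∈ Finset.range l, (q ^ (s + 1))⁻¹ * (1 - q⁻¹) =
        (q ^ (s + 1))⁻¹ - (q ^ (s + 1 + 1))⁻¹ := fun s _ => by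
      rw [mul_sub, mul_one, ← mul_inv, ← pow_succ]
    rw [Finset.sum_congr rfl this, Finset.sum_range_sub']
    simp
  rw [h2]
  simp only [eq_comm (a := k)]
  split_ifs <;> simp only [Nat.succ_eq_add_one] <;> ring

/-- Relative frequencies form a probability distribution. -/
lemma isProbLaw_of_ncard_div {α : Type*} [Finite α] {A : Set α} (hA : A.Nonempty) (Φ : α → ℕ)
    {p : ℤ → ℝ} (hp : ∀ k, p k = ({v | v ∈ A ∧ (Φ v : ℤ) = k}.ncard : ℝ) / (A.ncard : ℝ)) :
    IsProbLaw p := by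
  classical
  refine ⟨fun k => by rw [hp]; positivity, ?_⟩
  have hfin := Set.toFinite A
  have hA0 : (A.ncard : ℝ) ≠ 0 := by
    exact_mod_cast (Set.ncard_pos hfin).mpr hA |>.ne'
  have hcard : ∀ k, ({v | v ∈ A ∧ (Φ v : ℤ) = k}.ncard) =
      (hfin.toFinset.filter fun v => (Φ v : ℤ) = k).card := fun k => by
    rw [← Set.ncard_coe_finset]
    congr 1
    ext v
    simp
  have hsum : ∑ k ∈ hfin.toFinset.image (fun v => (Φ v : ℤ)), p k = 1 := by
    simp_rw [hp, hcard]
    rw [← Finset.sum_div, ← Nat.cast_sum,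
      ← Finset.card_eq_sum_card_fiberwise (fun v hv => Finset.mem_image_of_mem _ hv),
      ← Set.ncard_eq_toFinset_card, div_self hA0]
  rw [← hsum]
  refine hasSum_sum_of_ne_finset_zero fun k hk => ?_
  rw [hp, hcard, Finset.filter_false_of_mem, Finset.card_empty, Nat.cast_zero, zero_div]
  exact fun v hv h => hk (h ▸ Finset.mem_image_of_mem _ hv)

lemma IsIID.measureReal_forall_eq {ι Ω : Type*} [Fintype ι] [MeasurableSpace Ω] {P : Measure Ω}
    {Z : ι → Ω → ℤ} {p : ℤ → ℝ} (h : IsIID P Z p) (k : ι → ℤ) :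
    P.real {ω | ∀ i, Z i ω = k i} = ∏ i, p (k i) := by
  have h1 : {ω | ∀ i, Z i ω = k i} = ⋂ i ∈ Finset.univ, Z i ⁻¹' {k i} := by
    ext ω
    simp
  rw [Measure.real, h1, h.2.1.measure_inter_preimage_eq_mul Finset.univ
    (fun i _ => measurableSet_singleton (k i)), ENNReal.toReal_prod]
  exact Finset.prod_congr rfl fun i _ => h.2.2 i (k i)

end Law

/-! ### The number of points in terms of local data -/

section Points

variable {F : Type*} [Field F] {m n : ℕ} {f : F[X]}

lemma PowerFree.exists_eq_pow_mul (hf : PowerFree n f) (a : F) :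
    ∃ (s : Fin n) (g : F[X]), f = (X - C a) ^ (s : ℕ) * g ∧ g.eval a ≠ 0 ∧
      (∀ i < s, localData n f a i = 0) ∧ localData n f a s = g.eval a := by
  have hf0 : f ≠ 0 := by
    rintro rfl
    exact not_isUnit_zero (hf 0 (dvd_zero _))
  obtain ⟨g, hg, hga⟩ := exists_eq_pow_rootMultiplicity_mul_and_not_dvd f hf0 a
  set s := f.rootMultiplicity a
  have hs : s < n := by
    by_contra! h
    exact not_isUnit_X_sub_C a (hf _ ((pow_dvd_pow _ h).trans (Dvd.intro _ hg.symm)))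
  have hcoeff : taylor a f = X ^ s * taylor a g := by
    conv_lhs => rw [hg]
    rw [taylor_mul, taylor_pow]
    simp
  refine ⟨⟨s, hs⟩, g, hg, fun h => hga (dvd_iff_isRoot.mpr h), fun i hi => ?_, ?_⟩
  · rw [localData, hcoeff, coeff_X_pow_mul', if_neg]
    exact not_le.mpr hi
  · rw [localData, hcoeff, coeff_X_pow_mul', if_pos le_rfl, Nat.sub_self, taylor_coeff_zero]

lemma numPointsNorm_eq_leadingRootCount (hm : (m : F) ≠ 0) (hf : PowerFree n f) (a : F) :
    numPointsNorm m f a = leadingRootCount (fun s => m.gcd s) (localData n f a) := by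
  obtain ⟨s, g, hg, hga, h0, hs⟩ := hf.exists_eq_pow_mul a
  rw [leadingRootCount_eq _ h0 (by rwa [hs]), numPointsNorm_eq hm hg hga, hs]

lemma numPoints_eq_leadingRootCount (hm : m ≠ 0) (hf : PowerFree n f) (a : F) :
    numPoints m f a =
      leadingRootCount (fun s => if (s : ℕ) = 0 then m else 1) (localData n f a) := by
  obtain ⟨s, g, hg, hga, h0, hs⟩ := hf.exists_eq_pow_mul a
  rw [leadingRootCount_eq _ h0 (by rwa [hs]), numPoints, hs]
  split_ifs with h
  · rw [hg, h, pow_zero, one_mul]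
  · -- Both sides are `1`: the point `(a, 0)`, and the unique first root.
    have h1 : f.eval a = 0 := by
      rw [hg, eval_mul, eval_pow]
      simp [h]
    simp [h1, hm]

end Points

end Superelliptic

theorem theorem3 {F : Type*} [Field F] [Fintype F] (m n : ℕ) (hn : 2 ≤ n)
    (hm : Nat.Coprime (Fintype.card F) m) :
    Superelliptic.IsProbLaw (Superelliptic.curveLaw (Fintype.card F) m n) ∧
    Superelliptic.IsProbLaw (Superelliptic.normLaw (Fintype.card F) m n) ∧
    ∀ R : F[X] → Prop,
      (R = (fun _ => True) ∨
        R = Superelliptic.CurveIrred m ∨ R = Superelliptic.CurveGeomIrred m ∨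
        R = Superelliptic.NormIrred m ∨ R = Superelliptic.NormGeomIrred m) →
      ∀ (k : F → ℤ) {Ω : Type*} [MeasurableSpace Ω] (P : Measure Ω) [IsProbabilityMeasure P]
        (Z : F → Ω → ℤ),
        (Superelliptic.IsIID P Z (Superelliptic.curveLaw (Fintype.card F) m n) →
          Tendsto (Superelliptic.proportion n R (Superelliptic.numPoints m) k) atTop
            (𝓝 (P.real {ω | ∀ a, Z a ω = k a}))) ∧
        (Superelliptic.IsIID P Z (Superelliptic.normLaw (Fintype.card F) m n) →
          Tendsto (Superelliptic.proportion n R (Superelliptic.numPointsNorm m) k) atTop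
            (𝓝 (P.real {ω | ∀ a, Z a ω = k a}))) := by
  open Superelliptic in
  have hn0 : n ≠ 0 := by omega
  have hm0 : m ≠ 0 := by
    rintro rfl
    rw [Nat.coprime_zero_right] at hm
    exact absurd hm (Fintype.one_lt_card : 1 < Fintype.card F).ne'
  have hmF : (m : F) ≠ 0 := by
    obtain ⟨p, hchar⟩ := CharP.exists F
    have hp : p.Prime := CharP.char_is_prime F p
    intro h
    have h1 : p ∣ m := (CharP.cast_eq_zero_iff F p m).mp h
    have h2 : p ∣ Fintype.card F := (CharP.cast_eq_zero_iff F p _).mp (Nat.cast_card_eq_zero F)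
    exact Nat.not_coprime_of_dvd_of_dvd hp.one_lt h2 h1 hm
  have hne : {v : Fin n → F | v ≠ 0}.Nonempty :=
    ⟨fun _ => 1, fun h => one_ne_zero (congrFun h ⟨0, by omega⟩)⟩
  refine ⟨isProbLaw_of_ncard_div hne _ fun k => curveLaw_eq hm0 hn0 k,
    isProbLaw_of_ncard_div hne _ fun k => normLaw_eq hm0 hn0 k, ?_⟩
  intro R hR k Ω _ P _ Z
  have hgeom : ∀ f p : F[X], Irreducible p → p ∣ f → ¬ p ^ 2 ∣ f → CurveGeomIrred m f :=
    fun f p hp hpf hpf2 => curveGeomIrred_of_dvd hm0 hp hpf hpf2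
  have hirr : ∀ f p : F[X], Irreducible p → p ∣ f → ¬ p ^ 2 ∣ f → CurveIrred m f :=
    fun f p hp hpf hpf2 => irreducible_eqn hm0 hp.prime hpf hpf2
  have hR' : HoldsAlmostSurely R := by
    refine holdsAlmostSurely_of_simple_factor fun f p hp hpf hpf2 => ?_
    rcases hR with rfl | rfl | rfl | rfl | rfl
    · trivial
    · exact hirr f p hp hpf hpf2
    · exact hgeom f p hp hpf hpf2
    · exact normIrred_of_curveIrred (hirr f p hp hpf hpf2)
    · exact normGeomIrred_of_curveGeomIrred hm0 (hgeom f p hp hpf hpf2)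
  constructor
  · intro hZ
    rw [hZ.measureReal_forall_eq]
    simp_rw [curveLaw_eq hm0 hn0]
    exact tendsto_proportion hn hR' (fun f hf a => numPoints_eq_leadingRootCount hm0 hf a) k
  · intro hZ
    rw [hZ.measureReal_forall_eq]
    simp_rw [normLaw_eq hm0 hn0]
    exact tendsto_proportion hn hR'
      (fun f hf a => numPointsNorm_eq_leadingRootCount hmF hf a) k
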